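/- **Notation.** For a set $S$ of primes let $\mathbb Z_S\subseteq\mathbb Q$ be the localization of $\mathbb Z$ at the nonzero integers divisible by no prime of $S$ (so $\mathbb Z_{(p)}=\mathbb Z_{\{p\}}$). Let $\Gamma$ be a finite group and $\Gamma'\le\Gamma$. Put $a_{\Gamma/\Gamma'}=\operatorname{Ind}_{\Gamma'}^{\Gamma}1-1$, $a_\Gamma=a_{\Gamma/1}$ and $e_1'=|\Gamma'|^{-1}\sum_{\tau\in\Gamma'}\tau$. Let $e_{\Gamma/\Gamma'}\in\mathbb Q[\Gamma]$ be the central idempotent associated to $a_{\Gamma/\Gamma'}$, i.e. the minimal central idempotent acting as the identity on a $\mathbb Q$-representation with character $a_{\Gamma/\Gamma'}$. A prime $p$ is *good* for a central idempotent $e\in\mathbb Q[\Gamma]$ if $e\in\mathbb Z_{(p)}[\Gamma]$ and $e\mathbb Z_{(p)}[\Gamma]$ is a maximal $\mathbb Z_{(p)}$-order in $e\mathbb Q[\Gamma]$. For a $\mathbb Z_S$-order $\mathcal O$ in $\mathbb Q[\Gamma]$, a left superscript ${}^{\Gamma'}(\cdot)$ denotes the elements fixed by left multiplication by $\Gamma'$,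 and $\mathfrak o={}^{\Gamma'}(e_{\Gamma/\Gamma'}\mathcal O e_1')$, a ring with identity $e_{\Gamma/\Gamma'}e_1'$. *Rank.* Let $L/K_0$ be a Galois extension of number fields with group $\Gamma$. For each infinite place $v$ of $K_0$ let $\Gamma_v$ be a decomposition group at $v$, and put $\chi_L=-1+\sum_{v\mid\infty}\operatorname{Ind}_{\Gamma_v}^{\Gamma}1$. Let $e_i$ run over the irreducible central idempotents of $\mathbb Q[\Gamma]$ contained in $e_{\Gamma/\Gamma'}$, let $\varphi_i$ be any absolutely irreducible character contained in the irreducible rational character attached to $e_i$, and let $h_i^2$ be the dimension of $e_i\mathbb Q[\Gamma]$ over its center. The rank of $L^{\Gamma'}/K_0$ computed via $L$ is $\underline v=(v_i)$ with $$v_i=\frac{\langle\varphi_i,a_\Gamma\rangle}{\langle\varphi_i,a_{\Gamma/\Gamma'}\rangle}\,u_i,\qquad u_i=\frac1{h_i}\langle\chi_L,\varphi_i\rangle .$$ *Predicted distribution.* For a maximal $\mathbb Z_S$-order $\mathcal O$ and a finite $\mathfrak o$-module $H$ put $|H|^{\underline v}=\prod_i|e_ie_1'H|^{v_i}$. A random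 finite $\mathfrak o$-module has the distribution predicted by Cohen–Martinet for $(\mathfrak o,\underline v)$ if the probability of each isomorphism class $H$ is inversely proportional to $|H|^{\underline v}\,|\operatorname{Aut}_{\mathfrak o}(H)|$. **Theorem.** Let $K/K_0$ be a finite extension of number fields with Galois closure $L/K_0$, and let $M\supseteq L$ be a finite Galois extension of $K_0$. Let $\Gamma\cong\operatorname{Gal}(L/K_0)$ and $\Sigma\cong\operatorname{Gal}(M/K_0)$, let $\Gamma'\le\Gamma$ and $\Sigma'\le\Sigma$ be the subgroups corresponding to $\operatorname{Gal}(L/K)$ and $\operatorname{Gal}(M/K)$, let $\pi:\Sigma\to\Gamma$ be the surjection given by restriction, and let $\Delta=\ker\pi\cong\operatorname{Gal}(M/L)$. Let $S$ be a set of primes that are good both for $e_{\Gamma/\Gamma'}\in\mathbb Q[\Gamma]$ and for $e_{\Sigma/\Sigma'}\in\mathbb Q[\Sigma]$. Let $F:\mathbb Q[\Gamma]\to\mathbb Q[\Sigma]$ be the non-unital algebra embedding $\gamma\mapsto|\Delta|^{-1}\,\sigma\sum_{\delta\in\Delta}\delta$, where $\pi(\sigma)=\gamma$. 1. The map $F$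 restricts to a bijection from the irreducible central idempotents contained in $e_{\Gamma/\Gamma'}$ to those contained in $e_{\Sigma/\Sigma'}$. Under this bijection the rank $\underline v$ of $K=L^{\Gamma'}$ over $K_0$ computed via $L$ equals the rank $\tilde{\underline v}$ of $K=M^{\Sigma'}$ over $K_0$ computed via $M$ (for all choices of the absolutely irreducible characters). 2. Let $\mathcal O\subseteq\mathbb Q[\Gamma]$ and $\widetilde{\mathcal O}\subseteq\mathbb Q[\Sigma]$ be maximal $\mathbb Z_S$-orders such that the linear map $\gamma\mapsto\sigma\sum_{\delta\in\Delta}\delta$ $(\pi(\sigma)=\gamma)$ maps $\mathcal O$ into $\widetilde{\mathcal O}$. Then $F$ restricts to an isomorphism of additive groups ${}^{\Gamma'}(e_{\Gamma/\Gamma'}\mathcal O)\cong{}^{\Sigma'}(e_{\Sigma/\Sigma'}\widetilde{\mathcal O})$, and to a ring isomorphism $\theta:\mathfrak o={}^{\Gamma'}(e_{\Gamma/\Gamma'}\mathcal Oe_1')\cong\tilde{\mathfrak o}={}^{\Sigma'}(e_{\Sigma/\Sigma'}\widetilde{\mathcal O}E_1')$, where $E_1'=|\Sigma'|^{-1}\sum_{\sigma\in\Sigma'}\sigma$.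 3. In the situation of 2, if a finite $\mathfrak o$-module $H$ and a finite $\tilde{\mathfrak o}$-module $\widetilde H$ correspond to each other through $\theta$, then $|H|^{\underline v}=|\widetilde H|^{\tilde{\underline v}}$. Moreover, any distribution predicted for $(\mathfrak o,\underline v)$ and any distribution predicted for $(\tilde{\mathfrak o},\tilde{\underline v})$ give $H$ and $\widetilde H$ the same probability. So the predicted distributions obtained via $L$ and via $M$ agree. -/

import Mathlib

open scoped BigOperators

noncomputable section

namespace CohenMartinet

/-! ### `ℤ_S`, orders and maximal orders -/

/-- `ℤ_S`: the localization of `ℤ` at the nonzero integers not divisible by any prime of `S`,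
as a subring of `ℚ`. In particular `ZS {p}` is `ℤ_(p)` and `ZS ∅` is `ℚ`. -/
def ZS (S : Set Nat.Primes) : Subring ℚ where
  carrier := {q | ∃ a b : ℤ, (∀ p ∈ S, ¬ ((p : ℕ) : ℤ) ∣ b) ∧ b ≠ 0 ∧ q = a / b}
  mul_mem' := by
    rintro _ _ ⟨a, b, hb, hb0, rfl⟩ ⟨c, d, hd, hd0, rfl⟩
    refine ⟨a * c, b * d, fun p hp h => ?_, mul_ne_zero hb0 hd0, ?_⟩
    · rcases (Nat.prime_iff_prime_int.mp p.2).dvd_or_dvd h with h | h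
      exacts [hb p hp h, hd p hp h]
    · push_cast; rw [div_mul_div_comm]
  one_mem' := ⟨1, 1, fun p _ h =>
    (Nat.prime_iff_prime_int.mp p.2).not_isUnit (isUnit_of_dvd_one h), one_ne_zero, by simp⟩
  add_mem' := by
    rintro _ _ ⟨a, b, hb, hb0, rfl⟩ ⟨c, d, hd, hd0, rfl⟩
    refine ⟨a * d + b * c, b * d, fun p hp h => ?_, mul_ne_zero hb0 hd0, ?_⟩
    · rcases (Nat.prime_iff_prime_int.mp p.2).dvd_or_dvd h with h | h
      exacts [hb p hp h, hd p hp h]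
    · have h1 : (b : ℚ) ≠ 0 := by exact_mod_cast hb0
      have h2 : (d : ℚ) ≠ 0 := by exact_mod_cast hd0
      push_cast; rw [div_add_div _ _ h1 h2]
  zero_mem' := ⟨0, 1, fun p _ h =>
    (Nat.prime_iff_prime_int.mp p.2).not_isUnit (isUnit_of_dvd_one h), one_ne_zero, by simp⟩
  neg_mem' := by
    rintro _ ⟨a, b, hb, hb0, rfl⟩
    exact ⟨-a, b, hb, hb0, by push_cast; rw [neg_div]⟩

/-- `ℤ_S`-submodules of a `ℚ`-algebra. -/
abbrev ZSub (S : Set Nat.Primes) (A : Type*) [Ring A] [Algebra ℚ A] := Submodule (ZS S) A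

/-- `Λ` is a `ℤ_S`-order in the `ℚ`-algebra `f A f` (with identity `f`), where `f` is an
idempotent of `A`. For `f = 1` this is an order in `A`; for `f` central it is an order in `f A`. -/
structure IsOrder (S : Set Nat.Primes) {A : Type*} [Ring A] [Algebra ℚ A] (f : A)
    (Λ : ZSub S A) : Prop where
  le_corner : ∀ x ∈ Λ, f * x = x ∧ x * f = x
  one_mem : f ∈ Λ
  mul_mem : ∀ x ∈ Λ, ∀ y ∈ Λ, x * y ∈ Λ
  fg : Λ.FG
  spans : ∀ x : A, f * x = x → x * f = x → x ∈ Submodule.span ℚ (Λ : Set A)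

/-- `Λ` is a maximal `ℤ_S`-order in `f A f`. -/
def IsMaximalOrder (S : Set Nat.Primes) {A : Type*} [Ring A] [Algebra ℚ A] (f : A)
    (Λ : ZSub S A) : Prop :=
  IsOrder S f Λ ∧ ∀ Λ' : ZSub S A, IsOrder S f Λ' → Λ ≤ Λ' → Λ' = Λ

/-- `a Λ = {a x : x ∈ Λ}`. -/
def lmul {S : Set Nat.Primes} {A : Type*} [Ring A] [Algebra ℚ A] (a : A) (Λ : ZSub S A) :
    ZSub S A := Λ.map ((LinearMap.mulLeft ℚ a).restrictScalars (ZS S))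

/-- `Λ a = {x a : x ∈ Λ}`. -/
def rmul {S : Set Nat.Primes} {A : Type*} [Ring A] [Algebra ℚ A] (Λ : ZSub S A) (a : A) :
    ZSub S A := Λ.map ((LinearMap.mulRight ℚ a).restrictScalars (ZS S))

/-! ### Idempotents -/

/-- `e` is a central idempotent. -/
def IsCentralIdem {A : Type*} [Ring A] (e : A) : Prop :=
  IsIdempotentElem e ∧ ∀ x, e * x = x * e

/-- `ε` is an irreducible central idempotent. -/
def IsIrredCentralIdem {A : Type*} [Ring A] (ε : A) : Prop :=
  IsCentralIdem ε ∧ ε ≠ 0 ∧ ∀ f : A, IsCentralIdem f → ε * f = 0 ∨ ε * f = ε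

/-- The irreducible central idempotents `ε` contained in the central idempotent `e`. -/
abbrev Comp {A : Type*} [Ring A] (e : A) := {ε : A // IsIrredCentralIdem ε ∧ ε * e = ε}

/-- The number `h` with `h ^ 2 = dim_Z (ε A)`, `Z` the center of the simple algebra `ε A`. -/
def hdim {A : Type*} [Ring A] (ε : A) (hε : IsIrredCentralIdem ε) : ℕ :=
  Nat.sqrt (Module.finrank (Subring.center hε.1.1.Corner) hε.1.1.Corner)

section Group

variable {G : Type*} [Group G] [Fintype G]

/-- `ℤ_S[G] ⊆ ℚ[G]`. -/
def groupRing (S : Set Nat.Primes) (G : Type*) [Group G] : ZSub S (MonoidAlgebra ℚ G) :=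
  Submodule.span (ZS S) (Set.range (MonoidAlgebra.of ℚ G))

/-- The prime `p` is good for the central idempotent `e` of `ℚ[G]`: `e ∈ ℤ_(p)[G]` and
`e ℤ_(p)[G]` is a maximal `ℤ_(p)`-order in `e ℚ[G]`. -/
def IsGoodPrime (p : Nat.Primes) (e : MonoidAlgebra ℚ G) : Prop :=
  e ∈ groupRing {p} G ∧ IsMaximalOrder {p} e (lmul e (groupRing {p} G))

/-- `e₁' = |H|⁻¹ ∑_{τ ∈ H} τ`. -/
def avg (H : Subgroup G) : MonoidAlgebra ℚ G :=
  open Classical in (Nat.card H : ℚ)⁻¹ • ∑ τ : H, MonoidAlgebra.of ℚ G (τ : G)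

theorem of_mul_avg (H : Subgroup G) {h : G} (hh : h ∈ H) :
    MonoidAlgebra.of ℚ G h * avg H = avg H := by
  classical
  unfold avg
  rw [mul_smul_comm, Finset.mul_sum]
  congr 1
  refine Fintype.sum_equiv (Equiv.mulLeft (⟨h, hh⟩ : H)) _ _ fun τ => ?_
  simp only [Equiv.coe_mulLeft, Subgroup.coe_mul, map_mul]

theorem avg_isIdempotentElem (H : Subgroup G) : IsIdempotentElem (avg H) := by
  classical
  have h0 : (Nat.card H : ℚ) ≠ 0 := by exact_mod_cast Nat.card_pos.ne'
  unfold IsIdempotentElem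
  conv_lhs => enter [1]; unfold avg
  rw [smul_mul_assoc, Finset.sum_mul, Finset.sum_congr rfl fun τ _ => of_mul_avg H τ.2,
    Finset.sum_const, Finset.card_univ, ← Nat.card_eq_fintype_card, ← Nat.cast_smul_eq_nsmul ℚ,
    smul_smul, inv_mul_cancel₀ h0, one_smul]

/-- The central idempotent `f` of `ℚ[G]` acts as the identity on the augmentation representation,
the representation on the vectors of coefficient sum `0` in the permutation module `ℚ[G / H]`;
its character is `a_{G/H} = Ind_H^G 1 - 1`. -/
def ActsTriviallyOnAug (H : Subgroup G) (f : MonoidAlgebra ℚ G) : Prop :=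
  ∀ v : MonoidAlgebra ℚ (G ⧸ H), (v.coeff.sum fun _ a => a) = 0 →
    (Representation.ofMulAction ℚ G (G ⧸ H)).asAlgebraHom f v = v

/-- `e` is the minimal central idempotent acting as the identity on the augmentation
representation. -/
def IsAugIdem (H : Subgroup G) (e : MonoidAlgebra ℚ G) : Prop :=
  (IsCentralIdem e ∧ ActsTriviallyOnAug H e) ∧
    ∀ f, IsCentralIdem f → ActsTriviallyOnAug H f → e * f = e

theorem exists_isAugIdem (H : Subgroup G) : ∃ e, IsAugIdem H e := by
  classical
  let P : MonoidAlgebra ℚ G → Prop := fun e => IsCentralIdem e ∧ ActsTriviallyOnAug H e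
  have hfin : FiniteDimensional ℚ (MonoidAlgebra ℚ G) :=
    Module.Finite.equiv (MonoidAlgebra.coeffLinearEquiv ℚ (S := ℚ) (M := G)).symm
  let d : MonoidAlgebra ℚ G → ℕ := fun e =>
    Module.finrank ℚ (LinearMap.range (LinearMap.mulLeft ℚ e))
  have hP1 : P 1 := ⟨⟨IsIdempotentElem.one, fun x => by simp⟩, fun v _ => by simp⟩
  have hex : ∃ n, ∃ e, P e ∧ d e = n := ⟨_, 1, hP1, rfl⟩
  obtain ⟨e, he, hd⟩ := Nat.find_spec hex
  refine ⟨e, he, fun f hf hfa => ?_⟩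
  have hef : P (e * f) := by
    refine ⟨⟨?_, fun x => ?_⟩, fun v hv => ?_⟩
    · exact IsIdempotentElem.mul_of_commute (he.1.2 f) he.1.1 hf.1
    · rw [mul_assoc, hf.2 x, ← mul_assoc, he.1.2 x, mul_assoc]
    · rw [map_mul, Module.End.mul_apply, hfa v hv, he.2 v hv]
  have hle : LinearMap.range (LinearMap.mulLeft ℚ (e * f)) ≤
      LinearMap.range (LinearMap.mulLeft ℚ e) := by
    rintro _ ⟨x, rfl⟩
    exact ⟨f * x, by simp⟩
  have hmin : d e ≤ d (e * f) := by
    rw [hd]; exact Nat.find_min' hex ⟨_, hef, rfl⟩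
  have heq := Submodule.eq_of_le_of_finrank_le hle hmin
  have hmem : e ∈ LinearMap.range (LinearMap.mulLeft ℚ (e * f)) := by
    rw [heq]; exact ⟨1, by simp⟩
  obtain ⟨x, hx⟩ := hmem
  simp only [LinearMap.mulLeft_apply] at hx
  calc e * f = (e * f) * x * f := by rw [hx]
    _ = e * f * x := by
      rw [mul_assoc (e * f) x f, ← hf.2 x, ← mul_assoc, mul_assoc e f f, hf.1.eq]
    _ = e := hx

/-- `e_{G/H}`: the central idempotent of `ℚ[G]` associated to the augmentation character
`a_{G/H}`. -/
def augIdem (H : Subgroup G) : MonoidAlgebra ℚ G := (exists_isAugIdem H).choose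

theorem augIdem_spec (H : Subgroup G) : IsAugIdem H (augIdem H) := (exists_isAugIdem H).choose_spec

/-! ### Characters and ranks -/

/-- The inner product `⟨a, b⟩ = |G|⁻¹ ∑_g a(g) conj(b(g))` of class functions. -/
def cinner (a b : G → ℂ) : ℂ := (Nat.card G : ℂ)⁻¹ * ∑ g, a g * (starRingEnd ℂ) (b g)

/-- The character of `G` induced from the unit character of `H`. -/
def indUnit (H : Subgroup G) (g : G) : ℂ :=
  (Nat.card H : ℂ)⁻¹ * Nat.card {x : G // x⁻¹ * g * x ∈ H}

/-- The augmentation character `a_{G/H} = Ind_H^G 1 - 1`. -/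
def augChar (H : Subgroup G) (g : G) : ℂ := indUnit H g - 1

/-- `φ` is an absolutely irreducible character of `G` contained in the irreducible rational
character associated to the irreducible central idempotent `ε` of `ℚ[G]`, the character of the
irreducible rational representation on which `ε` acts as the identity. -/
def IsAbsIrrCharIn (ε : MonoidAlgebra ℚ G) (φ : G → ℂ) : Prop :=
  ∃ (n : ℕ) (ρ : Representation ℚ G (Fin n → ℚ)) (m : ℕ) (σ : Representation ℂ G (Fin m → ℂ)),
    ρ.IsIrreducible ∧ ρ.asAlgebraHom ε = 1 ∧ σ.IsIrreducible ∧ (∀ g, φ g = σ.character g) ∧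
      cinner φ (fun g => ((ρ.character g : ℚ) : ℂ)) ≠ 0

section Fields

variable (K₀ L : Type*) [Field K₀] [NumberField K₀] [Field L] [Algebra K₀ L]
  [FiniteDimensional K₀ L]

/-- A decomposition group in `G ≅ Gal(L/K₀)` of the infinite place `v` of `K₀`: the stabilizer
of a chosen infinite place of `L` above `v`. It is well defined up to conjugation. -/
def decompGroup (τ : Gal(L/K₀) ≃* G) (v : NumberField.InfinitePlace K₀) : Subgroup G :=
  (MulAction.stabilizer Gal(L/K₀)
    (NumberField.InfinitePlace.comap_surjective (k := K₀) (K := L) v).choose).map τ.toMonoidHom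

/-- `χ_L = -1 + ∑_{v ∣ ∞} Ind_{G_v}^G 1`. -/
def infChar (τ : Gal(L/K₀) ≃* G) (g : G) : ℂ :=
  -1 + ∑ v : NumberField.InfinitePlace K₀, indUnit (decompGroup K₀ L τ v) g

/-- The coordinate `u_ε = h⁻¹ ⟨χ_L, φ⟩` at `ε` of the rank of the Galois extension `L/K₀`. -/
def galRank (τ : Gal(L/K₀) ≃* G) (ε : MonoidAlgebra ℚ G) (hε : IsIrredCentralIdem ε)
    (φ : G → ℂ) : ℂ :=
  (hdim ε hε : ℂ)⁻¹ * cinner (infChar K₀ L τ) φ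

/-- The rank of `L^H/K₀` computed in `L`: the family
`v_ε = ⟨φ_ε, a_G⟩ / ⟨φ_ε, a_{G/H}⟩ * u_ε` indexed by the irreducible central idempotents `ε`
contained in `e_{G/H}`, where `φ_ε` is a choice of absolutely irreducible characters. These
numbers are rational. -/
def fixedRank (τ : Gal(L/K₀) ≃* G) (H : Subgroup G) (φ : Comp (augIdem H) → G → ℂ)
    (ε : Comp (augIdem H)) : ℂ :=
  cinner (φ ε) (augChar ⊥) / cinner (φ ε) (augChar H) * galRank K₀ L τ ε.1 ε.2.1 (φ ε)

/-- The image in `G ≅ Gal(L/K₀)` of `Gal(L/K)`, for `K₀ ⊆ K ⊆ L`. -/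
def galImage (K : Type*) [Field K] [Algebra K₀ K] [Algebra K L] [IsScalarTower K₀ K L]
    (τ : Gal(L/K₀) ≃* G) : Subgroup G :=
  ((IsScalarTower.toAlgHom K₀ K L).fieldRange.fixingSubgroup).map τ.toMonoidHom

end Fields

/-! ### Invariants and the ring `𝔬` -/

/-- `^H Λ`: the elements of `Λ ⊆ ℚ[G]` fixed by left multiplication by the elements of `H`. -/
def leftInv {S : Set Nat.Primes} (H : Subgroup G) (Λ : ZSub S (MonoidAlgebra ℚ G)) :
    ZSub S (MonoidAlgebra ℚ G) where
  carrier := {x | x ∈ Λ ∧ ∀ τ ∈ H, MonoidAlgebra.of ℚ G τ * x = x}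
  add_mem' := fun ha hb => ⟨Λ.add_mem ha.1 hb.1, fun τ hτ => by
    rw [mul_add, ha.2 τ hτ, hb.2 τ hτ]⟩
  zero_mem' := ⟨Λ.zero_mem, fun τ _ => mul_zero _⟩
  smul_mem' := fun c x hx => ⟨Λ.smul_mem c hx.1, fun τ hτ => by
    have := hx.2 τ hτ
    rw [Subring.smul_def, mul_smul_comm, this]⟩

theorem avg_mul_of_leftInv (H : Subgroup G) {x : MonoidAlgebra ℚ G}
    (hx : ∀ τ ∈ H, MonoidAlgebra.of ℚ G τ * x = x) : avg H * x = x := by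
  classical
  have h0 : (Nat.card H : ℚ) ≠ 0 := by exact_mod_cast Nat.card_pos.ne'
  unfold avg
  rw [smul_mul_assoc, Finset.sum_mul, Finset.sum_congr rfl fun (τ : H) _ => hx τ τ.2,
    Finset.sum_const, Finset.card_univ, ← Nat.card_eq_fintype_card, ← Nat.cast_smul_eq_nsmul ℚ,
    smul_smul, inv_mul_cancel₀ h0, one_smul]

/-- `e_{G/H} e₁'` is an idempotent; it is the identity of `e₁' e_{G/H} ℚ[G] e₁'`. -/
theorem augAvg_isIdempotentElem (H : Subgroup G) : IsIdempotentElem (augIdem H * avg H) :=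
  IsIdempotentElem.mul_of_commute ((augIdem_spec H).1.1.2 _) (augIdem_spec H).1.1.1
    (avg_isIdempotentElem H)

/-- The underlying module `^H(e_{G/H} 𝒪 e₁')` of `𝔬`. -/
def heckeModule {S : Set Nat.Primes} (H : Subgroup G) (O : ZSub S (MonoidAlgebra ℚ G)) :
    ZSub S (MonoidAlgebra ℚ G) :=
  leftInv H (rmul (lmul (augIdem H) O) (avg H))

theorem exists_of_mem_heckeModule {S : Set Nat.Primes} {H : Subgroup G}
    {O : ZSub S (MonoidAlgebra ℚ G)} {x : MonoidAlgebra ℚ G} (hx : x ∈ heckeModule H O) :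
    (∃ a ∈ O, x = augIdem H * a * avg H) ∧ ∀ τ ∈ H, MonoidAlgebra.of ℚ G τ * x = x := by
  obtain ⟨⟨_, ⟨a, ha, rfl⟩, rfl⟩, hx⟩ := hx
  exact ⟨⟨a, ha, rfl⟩, hx⟩

/-- The ring `𝔬 = ^H(e_{G/H} 𝒪 e₁')`, as a subring of `e₁' e_{G/H} ℚ[G] e₁'`, for an order `𝒪`
of `ℚ[G]`. -/
def heckeRing {S : Set Nat.Primes} (H : Subgroup G) (O : ZSub S (MonoidAlgebra ℚ G))
    (hO : IsOrder S 1 O) : Subring (augAvg_isIdempotentElem H).Corner where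
  carrier := {x | x.1 ∈ heckeModule H O}
  mul_mem' := by
    rintro x y hx hy
    obtain ⟨⟨a, ha, hxa⟩, hx2⟩ := exists_of_mem_heckeModule hx
    obtain ⟨⟨b, hb, hyb⟩, hy2⟩ := exists_of_mem_heckeModule hy
    have hc := (augIdem_spec H).1.1.2
    have hi := (augIdem_spec H).1.1.1.eq
    refine ⟨⟨_, ⟨a * b, hO.mul_mem a ha b hb, rfl⟩, ?_⟩, fun τ hτ => ?_⟩
    · change augIdem H * (a * b) * avg H = x.1 * y.1
      rw [hxa, mul_assoc _ (avg H), avg_mul_of_leftInv H hy2, hyb]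
      calc augIdem H * (a * b) * avg H = (augIdem H * augIdem H) * a * b * avg H := by
            rw [hi]; simp only [mul_assoc]
        _ = augIdem H * (augIdem H * a) * b * avg H := by simp only [mul_assoc]
        _ = augIdem H * (a * augIdem H) * b * avg H := by rw [hc a]
        _ = augIdem H * a * (augIdem H * b * avg H) := by simp only [mul_assoc]
    · change _ * (x.1 * y.1) = x.1 * y.1
      rw [← mul_assoc, hx2 τ hτ]
  one_mem' := by
    refine ⟨⟨_, ⟨1, hO.one_mem, rfl⟩, ?_⟩, fun τ hτ => ?_⟩
    · change augIdem H * 1 * avg H = augIdem H * avg H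
      rw [mul_one]
    · change _ * (augIdem H * avg H) = augIdem H * avg H
      rw [← mul_assoc, ← (augIdem_spec H).1.1.2, mul_assoc, of_mul_avg H hτ]
  add_mem' := fun ha hb => (heckeModule H O).add_mem ha hb
  zero_mem' := (heckeModule H O).zero_mem
  neg_mem' := fun ha => (heckeModule H O).neg_mem ha

/-- The element of `ℚ[G]` underlying an element of `𝔬`. -/
def heckeVal {S : Set Nat.Primes} {H : Subgroup G} {O : ZSub S (MonoidAlgebra ℚ G)}
    {hO : IsOrder S 1 O} (x : heckeRing H O hO) : MonoidAlgebra ℚ G := x.1.1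

/-! ### Random finite modules -/

/-- Finite modules over a ring. -/
structure FinMod (R : Type*) [Ring R] where
  carrier : Type
  [addCommGroup : AddCommGroup carrier]
  [module : Module R carrier]
  [finite : Finite carrier]

attribute [instance] FinMod.addCommGroup FinMod.module FinMod.finite

/-- Isomorphism of finite modules. -/
instance finModSetoid (R : Type*) [Ring R] : Setoid (FinMod R) where
  r X Y := Nonempty (X.carrier ≃ₗ[R] Y.carrier)
  iseqv := ⟨fun X => ⟨LinearEquiv.refl R X.carrier⟩, fun ⟨f⟩ => ⟨f.symm⟩,
    fun ⟨f⟩ ⟨g⟩ => ⟨f.trans g⟩⟩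

/-- Isomorphism classes of finite modules. -/
abbrev FinModClass (R : Type*) [Ring R] := Quotient (finModSetoid R)

/-- The component `(ε e₁') X` of an `𝔬`-module `X` at `ε`; here `ε e₁' ∈ 𝔬`, as the maximal
order `𝒪` contains the central idempotents of `ℚ[G]`. -/
def compPart {S : Set Nat.Primes} {H : Subgroup G} {O : ZSub S (MonoidAlgebra ℚ G)}
    {hO : IsOrder S 1 O} (ε : Comp (augIdem H)) (X : FinMod (heckeRing H O hO)) :
    Set X.carrier :=
  {x | ∃ a : heckeRing H O hO, heckeVal a = ε.1 * avg H ∧ ∃ y : X.carrier, x = a • y}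

/-- `|X|^v = ∏_ε |(ε e₁') X| ^ v_ε` for a family `v` of (rational) exponents. -/
def cardPow {S : Set Nat.Primes} {H : Subgroup G} {O : ZSub S (MonoidAlgebra ℚ G)}
    {hO : IsOrder S 1 O} (v : Comp (augIdem H) → ℂ) (X : FinMod (heckeRing H O hO)) : ℝ :=
  ∏ᶠ ε, ((compPart ε X).ncard : ℝ) ^ (v ε).re

/-- `P` is the distribution of the random finite `𝔬`-module with exponents `v`:
the probability of `X` is inversely proportional to `|X|^v |Aut_𝔬 X|`. -/
def IsRandomModuleLaw {S : Set Nat.Primes} {H : Subgroup G} {O : ZSub S (MonoidAlgebra ℚ G)}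
    {hO : IsOrder S 1 O} (v : Comp (augIdem H) → ℂ)
    (P : PMF (FinModClass (heckeRing H O hO))) : Prop :=
  ∀ X Y : FinMod (heckeRing H O hO),
    P ⟦X⟧ * ENNReal.ofReal
        (cardPow v X * Nat.card (X.carrier ≃ₗ[heckeRing H O hO] X.carrier)) =
      P ⟦Y⟧ * ENNReal.ofReal
        (cardPow v Y * Nat.card (Y.carrier ≃ₗ[heckeRing H O hO] Y.carrier))

/-! ### Comparison of two groups -/

variable {E : Type*} [Group E] [Fintype E]

/-- For a surjection `π : E → G` with kernel `Δ`, the linear map `ℚ[G] → ℚ[E]` sending `γ` to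
`∑_{π(σ) = γ} σ = σ ∑_{δ ∈ Δ} δ` (for any `σ` over `γ`). -/
def cosetSum (π : E →* G) : MonoidAlgebra ℚ G →ₗ[ℚ] MonoidAlgebra ℚ E where
  toFun x := ∑ s : E, MonoidAlgebra.single s (x.coeff (π s))
  map_add' x y := by simp [MonoidAlgebra.single_add, Finset.sum_add_distrib]
  map_smul' c x := by simp [Finset.smul_sum, MonoidAlgebra.smul_single]

theorem coeff_cosetSum (π : E →* G) (x : MonoidAlgebra ℚ G) (s : E) :
    (cosetSum π x).coeff s = x.coeff (π s) := by
  classical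
  change (∑ s : E, MonoidAlgebra.single s (x.coeff (π s))).coeff s = x.coeff (π s)
  simp [Finsupp.single_apply, Finsupp.finsetSum_apply]

theorem sum_comp_surjective (π : E →* G) (hπ : Function.Surjective π) (f : G → ℚ) :
    ∑ s : E, f (π s) = Nat.card π.ker * ∑ g : G, f g := by
  classical
  have key : ∀ g : G, (Finset.univ.filter fun s : E => π s = g).card = Nat.card π.ker := by
    intro g
    rw [MonoidHom.card_fiber_eq_of_mem_range π (hπ g) (hπ 1), Nat.card_eq_fintype_card,
      Fintype.card_subtype]
    exact congrArg Finset.card (Finset.filter_congr fun s _ => π.mem_ker.symm)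
  rw [← Finset.sum_fiberwise Finset.univ π, Finset.mul_sum]
  refine Finset.sum_congr rfl fun g _ => ?_
  rw [Finset.sum_congr rfl (g := fun _ => f g) fun s hs => by rw [(Finset.mem_filter.mp hs).2],
    Finset.sum_const, key, nsmul_eq_mul]

theorem cosetSum_mul (π : E →* G) (hπ : Function.Surjective π) (x y : MonoidAlgebra ℚ G) :
    cosetSum π x * cosetSum π y = (Nat.card π.ker : ℚ) • cosetSum π (x * y) := by
  classical
  ext s
  have h : ∀ (F : Type _) [Group F] [Fintype F] (a b : MonoidAlgebra ℚ F) (s : F),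
      (a * b).coeff s = ∑ t : F, a.coeff t * b.coeff (t⁻¹ * s) := by
    intro F _ _ a b s
    rw [MonoidAlgebra.coeff_mul_apply_left, Finsupp.sum_fintype _ _ (by simp)]
  have h' : ∀ (a b : MonoidAlgebra ℚ E) (s : E),
      (a * b).coeff s = ∑ t : E, a.coeff t * b.coeff (t⁻¹ * s) := by
    intro a b s
    rw [MonoidAlgebra.coeff_mul_apply_left, Finsupp.sum_fintype _ _ (by simp)]
  rw [h', MonoidAlgebra.coeff_smul, Finsupp.smul_apply, coeff_cosetSum, h]
  simp only [coeff_cosetSum, map_mul, map_inv, smul_eq_mul]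
  exact sum_comp_surjective π hπ fun t => x.coeff t * y.coeff (t⁻¹ * π s)

/-- For a surjection `π : E → G` with kernel `Δ`, the (non-unital) algebra embedding
`ℚ[G] → ℚ[E]`, `γ ↦ |Δ|⁻¹ σ ∑_{δ ∈ Δ} δ` where `π(σ) = γ`. It is an isomorphism onto `F₁ ℚ[E]`,
`F₁ = |Δ|⁻¹ ∑_{δ ∈ Δ} δ`. -/
def inflation (π : E →* G) (hπ : Function.Surjective π) :
    MonoidAlgebra ℚ G →ₙₐ[ℚ] MonoidAlgebra ℚ E where
  toFun x := (Nat.card π.ker : ℚ)⁻¹ • cosetSum π x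
  map_zero' := by simp
  map_add' x y := by simp
  map_smul' c x := by
    rw [map_smul]
    exact smul_comm _ _ _
  map_mul' x y := by
    have h0 : (Nat.card π.ker : ℚ) ≠ 0 := by exact_mod_cast Nat.card_pos.ne'
    rw [smul_mul_smul_comm, cosetSum_mul π hπ, smul_smul, mul_assoc, inv_mul_cancel₀ h0, mul_one]

section Restriction

variable {K₀ L M : Type*} [Field K₀] [Field L] [Field M] [Algebra K₀ L] [Algebra K₀ M]
  [Algebra L M] [IsScalarTower K₀ L M] [Normal K₀ L] {Γ Ξ : Type*} [Group Γ] [Group Ξ]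

/-- The surjection `Ξ → Γ` corresponding to the restriction map `Gal(M/K₀) → Gal(L/K₀)`. -/
def restrictHom (τL : Gal(L/K₀) ≃* Γ) (τM : Gal(M/K₀) ≃* Ξ) : Ξ →* Γ :=
  τL.toMonoidHom.comp ((AlgEquiv.restrictNormalHom L).comp τM.symm.toMonoidHom)

theorem restrictHom_surjective [Normal K₀ M] (τL : Gal(L/K₀) ≃* Γ) (τM : Gal(M/K₀) ≃* Ξ) :
    Function.Surjective (restrictHom τL τM) :=
  τL.surjective.comp ((AlgEquiv.restrictNormalHom_surjective M).comp τM.symm.surjective)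

end Restriction

end Group

end CohenMartinet

end

open CohenMartinet

/-! Write `F` for `inflation`, with left inverse the unital ring map `deflation`. Everything rests
on the projection formula `F(x) * y = F(x * deflation y)` and its mirror image: `F` identifies
`ℚ[Γ]` with the ideal `F(1) ℚ[Σ]`, where `F(1)` is the average over `Δ`. Since `K ⊆ L`, `Σ'` is the
full preimage of `Γ'`, so `ℚ[Σ/Σ']` is the inflation of `ℚ[Γ/Γ']`. Hence `F` carries `e_{Γ/Γ'}` to
`e_{Σ/Σ'}`, `e₁'` to `E₁'`, and the irreducible central idempotents below the one to those below the
other.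

Ranks: by Frobenius reciprocity every inner product in the rank is a combination of traces of
averages `avg H`, and `deflation` sends `avg H` to `avg (π H)`. Restriction of places shows that `π`
maps decomposition groups onto decomposition groups up to conjugation. A character belonging to
`F(ε)` is inflated from one belonging to `ε`, but possibly not from the one chosen over `Γ`. The
choice is harmless: `ε ℚ[Γ]` is central simple over its center `Z`, and comparing it with `End_ℂ(V)`
gives `h = dim V` and `h * tr(f) = dim_Z (ε f ℚ[Γ])` for every rational idempotent `f`. The right
side does not involve `V` (`finrank_eq_hdim_and_trace`).

Orders: the coefficients of `e_{Γ/Γ'}` are `|Δ|` times those of `e_{Σ/Σ'}`, which lie in `ℤ_(p)` at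
a good prime. If `p ∣ |Δ|`, the idempotent `e_{Γ/Γ'}` would be divisible by `p`, hence zero. So,
unless this idempotent vanishes, `|Δ|` is a unit of `ℤ_S`. Then the deflation of the big order is an
order containing the small one, and equals it by maximality. The projection formula now gives the
isomorphisms of invariants and of the rings `𝔬`.

Distributions: the ring isomorphism preserves component sizes and automorphism groups, so the
weights agree, and a probability law is determined by its weights. -/

theorem LinearMap.trace_mulLeft {k V : Type*} [Field k] [AddCommGroup V] [Module k V]
    [FiniteDimensional k V] (T : Module.End k V) :
    LinearMap.trace k (Module.End k V) (LinearMap.mulLeft k T) =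
      Module.finrank k V * LinearMap.trace k V T := by
  -- Under `End V ≅ V* ⊗ V`, composition with `T` on the left acts only on the factor `V`.
  have h : LinearMap.mulLeft k T = (dualTensorHomEquiv k V V).conj
      (TensorProduct.map LinearMap.id T) := by
    have h' : LinearMap.mulLeft k T ∘ₗ dualTensorHom k V V =
        dualTensorHom k V V ∘ₗ TensorProduct.map LinearMap.id T := by
      ext x y v
      simp
    ext1 S
    obtain ⟨t, rfl⟩ := (dualTensorHomEquiv k V V).surjective S
    rw [LinearEquiv.conj_apply_apply, LinearEquiv.symm_apply_apply]
    exact LinearMap.congr_fun h' t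
  rw [h, LinearMap.trace_conj' (M := TensorProduct k (Module.Dual k V) V) (N := Module.End k V) _
    (dualTensorHomEquiv k V V)]
  rw [LinearMap.trace_tensorProduct', LinearMap.trace_id, Subspace.dual_finrank_eq]

/-! ### Central simple algebras and their absolutely irreducible representations -/

section CentralSimple

variable {Z A : Type*} [Field Z] [Ring A] [Algebra Z A]

/-- The algebra of `Z`-linear endomorphisms of `A` generated by left and right multiplications. -/
def mulAlgebra (Z A : Type*) [Field Z] [Ring A] [Algebra Z A] : Subalgebra Z (Module.End Z A) :=
  Algebra.adjoin Z (Set.range (LinearMap.mulLeft Z (A := A)) ∪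
    Set.range (LinearMap.mulRight Z (A := A)))

theorem mulLeft_mem_mulAlgebra (a : A) : LinearMap.mulLeft Z a ∈ mulAlgebra Z A :=
  Algebra.subset_adjoin (Or.inl ⟨a, rfl⟩)

theorem mulRight_mem_mulAlgebra (a : A) : LinearMap.mulRight Z a ∈ mulAlgebra Z A :=
  Algebra.subset_adjoin (Or.inr ⟨a, rfl⟩)

/-- Submodules for left and right multiplications together are two-sided ideals. -/
theorem isSimpleModule_mulAlgebra [IsSimpleRing A] : IsSimpleModule (mulAlgebra Z A) A := by
  rw [isSimpleModule_iff]
  have : Nontrivial (Submodule (mulAlgebra Z A) A) := inferInstance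
  refine { eq_bot_or_eq_top := fun N => ?_ }
  have hN := (isSimpleRing_iff_isTwoSided_imp.mp ‹IsSimpleRing A›).2
  let I : Ideal A :=
    { carrier := N
      add_mem' := N.add_mem
      zero_mem' := N.zero_mem
      smul_mem' := fun c x hx => N.smul_mem ⟨_, mulLeft_mem_mulAlgebra c⟩ hx }
  have hI : I.IsTwoSided := ⟨fun {x} b hx => N.smul_mem ⟨_, mulRight_mem_mulAlgebra b⟩ hx⟩
  rcases hN I hI with h | h
  · left
    ext x
    exact (Submodule.ext_iff.mp h x)
  · right
    ext x
    exact (Submodule.ext_iff.mp h x)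

/-- An endomorphism of `A` commuting with all left and right multiplications is multiplication by
its value at `1`, which is central, hence a scalar of `Z`. The density theorem for the simple module
`A` then yields every `Z`-linear map. -/
theorem mulAlgebra_eq_top [Algebra.IsCentral Z A] [IsSimpleRing A] [FiniteDimensional Z A] :
    mulAlgebra Z A = ⊤ := by
  have := isSimpleModule_mulAlgebra (Z := Z) (A := A)
  classical
  rw [eq_top_iff]
  intro T _
  have hφ : ∀ φ : Module.End (mulAlgebra Z A) A, ∃ z : Z, ∀ x, φ x = z • x := by
    intro φ
    have h1 : ∀ x, φ x = x * φ 1 := fun x => by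
      conv_lhs => rw [← mul_one x]
      exact φ.map_smul ⟨_, mulLeft_mem_mulAlgebra x⟩ 1
    have h2 : ∀ x, φ x = φ 1 * x := fun x => by
      conv_lhs => rw [← one_mul x]
      exact φ.map_smul ⟨_, mulRight_mem_mulAlgebra x⟩ 1
    obtain ⟨z, hz⟩ := Algebra.IsCentral.mem_center_iff (K := Z) (D := A) |>.mp
      (Subalgebra.mem_center_iff.mpr fun b => (h1 b).symm.trans (h2 b) :
        φ 1 ∈ Subalgebra.center Z A)
    exact ⟨z, fun x => by rw [h2, hz, Algebra.smul_def]⟩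
  let T' : Module.End (Module.End (mulAlgebra Z A) A) A :=
    { toFun := T
      map_add' := T.map_add
      map_smul' := fun φ x => by
        obtain ⟨z, hz⟩ := hφ φ
        simp [hz] }
  let b := Module.finBasis Z A
  obtain ⟨r, hr⟩ := jacobson_density (R := mulAlgebra Z A) T' (Finset.univ.image b)
  have : T = r.1 := b.ext fun i => hr (b i) (by simp)
  rw [this]
  exact r.2

/-- Scalar extension of a central simple algebra along `ζ` is injective on `A`. -/
theorem linearIndependent_of_isSimpleRing [Algebra.IsCentral Z A] [IsSimpleRing A]
    [FiniteDimensional Z A] {C B : Type*} [Field C] [Ring B] [Algebra C B]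
    [Nontrivial B] (s : A →+* B) (ζ : Z →+* C)
    (hζ : ∀ z, s (algebraMap Z A z) = algebraMap C B (ζ z)) {ι : Type*} [Fintype ι]
    (b : Module.Basis ι Z A) : LinearIndependent C (s ∘ b) := by
  classical
  rw [Fintype.linearIndependent_iff]
  intro c hc i
  -- The given relation says `Φ 1 = 0`. Vanishing of `Φ` survives composition with left and right
  -- multiplications, hence with every endomorphism; the one sending `b i` to `1` and the other
  -- basis vectors to `0` isolates `c i`.
  let Φ : Module.End Z A → B := fun T => ∑ k, c k • s (T (b k))
  have key : ∀ T ∈ mulAlgebra Z A, ∀ U : Module.End Z A, Φ U = 0 → Φ (T * U) = 0 := by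
    intro T hT
    induction hT using Algebra.adjoin_induction with
    | mem T hT =>
      intro U hU
      rcases hT with ⟨a, rfl⟩ | ⟨a, rfl⟩
      · have : Φ (LinearMap.mulLeft Z a * U) = s a * Φ U := by
          simp [Φ, Finset.mul_sum]
        rw [this, hU, mul_zero]
      · have : Φ (LinearMap.mulRight Z a * U) = Φ U * s a := by
          simp [Φ, Finset.sum_mul]
        rw [this, hU, zero_mul]
    | algebraMap z =>
      intro U hU
      have : Φ (algebraMap Z _ z * U) = algebraMap C B (ζ z) * Φ U := by
        simp only [Φ, Finset.mul_sum, ← hζ, Module.End.mul_apply, Module.algebraMap_end_apply,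
          Algebra.smul_def z, map_mul, mul_smul_comm]
      rw [this, hU, mul_zero]
    | add T T' _ _ h h' =>
      intro U hU
      have : Φ ((T + T') * U) = Φ (T * U) + Φ (T' * U) := by
        simp [Φ, Finset.sum_add_distrib]
      rw [this, h U hU, h' U hU, add_zero]
    | mul T T' _ _ h h' =>
      intro U hU
      rw [mul_assoc]
      exact h _ (h' U hU)
  have h1 : Φ 1 = 0 := by simpa [Φ] using hc
  let T : Module.End Z A := b.constr Z (Pi.single i (1 : A))
  have h2 := key T (mulAlgebra_eq_top (Z := Z) (A := A) ▸ Algebra.mem_top) 1 h1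
  have h3 : Φ (T * 1) = algebraMap C B (c i) := by
    simp only [Φ, T, mul_one, Module.Basis.constr_basis]
    rw [Finset.sum_eq_single i (fun k _ hk => by simp [hk]) (by simp)]
    simp [Algebra.algebraMap_eq_smul_one]
  rw [h3] at h2
  simpa using h2

variable {C V : Type*} [Field C] [AddCommGroup V] [Module C V] [FiniteDimensional C V]
  [Nontrivial V]

/-- The image of `Z` commutes with the image of `A`, which spans `End V`, so it consists of scalars.
-/
theorem exists_scalar_center (s : A →+* Module.End C V)
    (hs : Submodule.span C (Set.range s) = ⊤) :
    ∃ ζ : Z →+* C, ∀ z, s (algebraMap Z A z) = algebraMap C (Module.End C V) (ζ z) := by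
  have h : ∀ z : Z, ∃ c : C, algebraMap C (Module.End C V) c = s (algebraMap Z A z) := by
    intro z
    have : s (algebraMap Z A z) ∈ Subalgebra.center C (Module.End C V) := by
      rw [Subalgebra.mem_center_iff]
      intro T
      have hT : T ∈ Submodule.span C (Set.range s) := hs ▸ Submodule.mem_top
      induction hT using Submodule.span_induction with
      | mem T hT =>
        obtain ⟨a, rfl⟩ := hT
        rw [← map_mul, ← map_mul, Algebra.commutes]
      | zero => simp
      | add T T' _ _ h h' => rw [add_mul, mul_add, h, h']
      | smul c T _ h => rw [smul_mul_assoc, mul_smul_comm, h]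
    obtain ⟨c, hc⟩ := Algebra.IsCentral.mem_center_iff (K := C) |>.mp this
    exact ⟨c, hc.symm⟩
  choose ζ hζ using h
  have inj : Function.Injective (algebraMap C (Module.End C V)) :=
    FaithfulSMul.algebraMap_injective _ _
  exact ⟨{ toFun := ζ
           map_one' := inj (by simp [hζ])
           map_mul' := fun x y => inj (by simp [hζ])
           map_zero' := inj (by simp [hζ])
           map_add' := fun x y => inj (by simp [hζ]) }, fun z => (hζ z).symm⟩

variable (Z) in
-- A `Z`-basis of `A` becomes a `C`-basis of `End V`, which gives the dimension. In these bases left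
-- multiplication by `s f` has the matrix of left multiplication by `f`, moved along `ζ`; the trace
-- of the latter is the rank of an idempotent, while that of the former is `dim V` times the trace
-- of `s f`.
theorem finrank_eq_and_trace_of_span_eq_top [Algebra.IsCentral Z A] [IsSimpleRing A]
    [FiniteDimensional Z A]
    (s : A →+* Module.End C V)
    (hs : Submodule.span C (Set.range s) = ⊤) :
    Module.finrank Z A = Module.finrank C V ^ 2 ∧ ∀ f : A, IsIdempotentElem f →
      (Module.finrank C V : C) * LinearMap.trace C V (s f) =
        (Module.finrank Z (LinearMap.range (LinearMap.mulLeft Z f)) : C) := by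
  classical
  obtain ⟨ζ, hζ⟩ := exists_scalar_center (Z := Z) s hs
  let b := Module.finBasis Z A
  have hli := linearIndependent_of_isSimpleRing s ζ hζ b
  have hexp : ∀ a : A, s a = ∑ i, ζ (b.repr a i) • s (b i) := by
    intro a
    conv_lhs => rw [← b.sum_repr a]
    simp [Algebra.smul_def, hζ]
  have hsp : ⊤ ≤ Submodule.span C (Set.range (s ∘ b)) := by
    rw [← hs, Submodule.span_le]
    rintro _ ⟨a, rfl⟩
    rw [hexp]
    exact Submodule.sum_mem _ fun i _ =>
      Submodule.smul_mem _ _ (Submodule.subset_span ⟨i, rfl⟩)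
  let B := Module.Basis.mk hli hsp
  refine ⟨?_, fun f hf => ?_⟩
  · have h1 := Module.finrank_eq_card_basis B
    rw [Module.finrank_linearMap, Fintype.card_fin] at h1
    rw [← h1, sq]
  · rw [← LinearMap.trace_mulLeft, LinearMap.trace_eq_matrix_trace C B]
    have hm : LinearMap.toMatrix B B (LinearMap.mulLeft C (s f)) =
        (LinearMap.toMatrix b b (LinearMap.mulLeft Z f)).map ζ := by
      ext i j
      rw [LinearMap.toMatrix_apply, Matrix.map_apply, LinearMap.toMatrix_apply]
      have : LinearMap.mulLeft C (s f) (B j) = ∑ i, ζ (b.repr (f * b j) i) • B i := by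
        simp only [B, Module.Basis.mk_apply, Function.comp, LinearMap.mulLeft_apply, ← map_mul]
        exact hexp _
      rw [this, Module.Basis.repr_sum_self, LinearMap.mulLeft_apply]
    have hidem : IsIdempotentElem (LinearMap.mulLeft Z f) := by
      ext x
      simp [← mul_assoc, hf.eq]
    rw [hm, show ∀ N : Matrix _ _ Z, (N.map ζ).trace = ζ N.trace from
      fun N => (AddMonoidHom.map_trace (ζ : Z →+ C) N).symm, ← LinearMap.trace_eq_matrix_trace Z b,
      (LinearMap.IsIdempotentElem.isProj_range _ hidem).trace]
    simp

end CentralSimple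

noncomputable section

namespace CohenMartinet

/-! ### The simple components of a semisimple ring -/

section Corner

variable {R : Type*} [Ring R]

theorem IsCentralIdem.mem_corner_iff {ε : R} (hε : IsCentralIdem ε) {x : R} :
    (∃ r, ε * r * ε = x) ↔ ε * x = x := by
  constructor
  · rintro ⟨r, rfl⟩
    simp only [← mul_assoc, hε.1.eq]
  · intro h
    exact ⟨x, by rw [h, ← hε.2, h]⟩

/-- A left ideal which is also a right ideal of a semisimple ring is generated by a central
idempotent. -/
theorem exists_isCentralIdem_of_isTwoSided [IsSemisimpleRing R] (I : Ideal R)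
    (hI : ∀ x ∈ I, ∀ r, x * r ∈ I) :
    ∃ f : R, IsCentralIdem f ∧ ∀ x, x ∈ I ↔ f * x = x := by
  obtain ⟨f, hf, rfl⟩ := IsSemisimpleRing.ideal_eq_span_idempotent I
  have hmem : ∀ x, x ∈ Ideal.span {f} ↔ x * f = x := by
    intro x
    rw [Ideal.mem_span_singleton']
    constructor
    · rintro ⟨a, rfl⟩
      rw [mul_assoc, hf.eq]
    · exact fun h => ⟨x, h⟩
  have hfI : f ∈ Ideal.span {f} := Ideal.mem_span_singleton_self f
  have hleft : ∀ x ∈ Ideal.span {f}, f * x = x := by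
    -- the left ideal generated by `(1 - f) * x` squares to zero
    intro x hx
    obtain ⟨g, hg, hJ⟩ := IsSemisimpleRing.ideal_eq_span_idempotent (Ideal.span {(1 - f) * x})
    have hgJ : g ∈ Ideal.span {(1 - f) * x} := hJ ▸ Ideal.mem_span_singleton_self g
    obtain ⟨a, ha⟩ := Ideal.mem_span_singleton'.mp hgJ
    have h0 : x * a * (1 - f) = 0 := by
      rw [mul_sub, mul_one, (hmem _).mp (hI x hx a), sub_self]
    have hg0 : g = 0 := by
      rw [← hg.eq, ← ha]
      calc a * ((1 - f) * x) * (a * ((1 - f) * x)) = a * (1 - f) * (x * a * (1 - f)) * x := by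
            simp only [mul_assoc]
        _ = 0 := by rw [h0]; simp
    have : (1 - f) * x ∈ Ideal.span {g} := hJ ▸ Ideal.mem_span_singleton_self _
    rw [hg0, Ideal.span_singleton_eq_bot.mpr rfl, Ideal.mem_bot, sub_mul, one_mul,
      sub_eq_zero] at this
    exact this.symm
  refine ⟨f, ⟨hf, fun x => ?_⟩, fun x => ⟨hleft x, fun h => ?_⟩⟩
  · rw [← (hmem _).mp (hI f hfI x), mul_assoc, hleft _ (Ideal.mul_mem_left _ x hfI)]
  · rw [← h]; exact hI f hfI x

/-- The projection of `R` to the corner ring `ε R ε`. -/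
def cornerMk {ε : R} (hε : IsIrredCentralIdem ε) (r : R) : hε.1.1.Corner := ⟨ε * r * ε, r, rfl⟩

/-- A two-sided ideal of the corner is one of `R`, hence generated by a central idempotent `f`;
irreducibility leaves only `ε f = 0` or `ε f = ε`. -/
theorem IsIrredCentralIdem.isSimpleRing_corner [IsSemisimpleRing R] {ε : R}
    (hε : IsIrredCentralIdem ε) : IsSimpleRing hε.1.1.Corner := by
  rw [isSimpleRing_iff_isTwoSided_imp]
  have hcorner : ∀ a : hε.1.1.Corner, ε * a.1 = a.1 := fun a => hε.1.mem_corner_iff.mp a.2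
  refine ⟨⟨⟨0, 1, fun h => hε.2.1 (congrArg Subtype.val h).symm⟩⟩, fun I hI => ?_⟩
  let c := cornerMk hε
  have hl : ∀ r (a : hε.1.1.Corner), r * a.1 = (c r * a).1 := fun r a => by
    change r * a.1 = ε * r * ε * a.1
    rw [mul_assoc (ε * r), hcorner, hε.1.2, mul_assoc, hcorner]
  have hr : ∀ r (a : hε.1.1.Corner), a.1 * r = (a * c r).1 := fun r a => by
    change a.1 * r = a.1 * (ε * r * ε)
    rw [← hε.1.2 (ε * r), ← mul_assoc ε ε, hε.1.1.eq, ← mul_assoc, ← hε.1.2, hcorner]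
  let J : Ideal R :=
    { carrier := {x | ∃ a ∈ I, a.1 = x}
      add_mem' := by
        rintro _ _ ⟨a, ha, rfl⟩ ⟨b, hb, rfl⟩
        exact ⟨a + b, I.add_mem ha hb, rfl⟩
      zero_mem' := ⟨0, I.zero_mem, rfl⟩
      smul_mem' := by
        rintro r _ ⟨a, ha, rfl⟩
        exact ⟨_, I.mul_mem_left (c r) ha, (hl r a).symm⟩ }
  obtain ⟨f, hf, hJ⟩ := exists_isCentralIdem_of_isTwoSided J (by
    rintro _ ⟨a, ha, rfl⟩ r
    exact ⟨_, hI.mul_mem_of_left (c r) ha, (hr r a).symm⟩)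
  rcases hε.2.2 f hf with h | h
  · left
    rw [eq_bot_iff]
    intro a ha
    have h1 : f * a.1 = a.1 := (hJ _).mp ⟨a, ha, rfl⟩
    refine Subtype.ext (?_ : a.1 = 0)
    rw [← hcorner a, ← h1, ← mul_assoc, h, zero_mul]
  · right
    rw [eq_top_iff]
    intro a _
    have h1 : f * a.1 = a.1 := by rw [← hcorner a, ← mul_assoc, ← hε.1.2 f, h]
    obtain ⟨b, hb, hab⟩ := (hJ _).mpr h1
    exact (Subtype.ext hab : b = a) ▸ hb

theorem IsIrredCentralIdem.finite_corner [Algebra ℚ R] [FiniteDimensional ℚ R] {ε : R}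
    (hε : IsIrredCentralIdem ε) :
    Module.Finite (Subring.center hε.1.1.Corner) hε.1.1.Corner := by
  let c := cornerMk hε
  let b := Module.finBasis ℚ R
  have hz : ∀ q : ℚ, c (algebraMap ℚ R q) ∈ Subring.center hε.1.1.Corner := by
    intro q
    rw [Subring.mem_center_iff]
    intro a
    refine Subtype.ext ?_
    change a.1 * (ε * algebraMap ℚ R q * ε) = ε * algebraMap ℚ R q * ε * a.1
    rw [← Algebra.commutes q ε, mul_assoc _ ε ε, hε.1.1.eq, Algebra.commutes q ε, ← mul_assoc,
      ← hε.1.2, mul_assoc, mul_assoc, Algebra.commutes]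
  rw [Module.finite_def, Submodule.fg_def]
  refine ⟨Set.range fun i => c (b i), Set.finite_range _, ?_⟩
  rw [eq_top_iff]
  intro a _
  have ha : a = ∑ i, (⟨c (algebraMap ℚ R (b.repr a.1 i)), hz _⟩ :
      Subring.center hε.1.1.Corner) • c (b i) := by
    let p : hε.1.1.Corner →+ R :=
      { toFun := Subtype.val, map_zero' := rfl, map_add' := fun _ _ => rfl }
    refine Subtype.ext (?_ : p a = p _)
    rw [map_sum]
    have h1 : ∀ i, p ((⟨c (algebraMap ℚ R (b.repr a.1 i)), hz _⟩ :
        Subring.center hε.1.1.Corner) • c (b i)) = ε * (b.repr a.1 i • b i) := by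
      intro i
      change ε * algebraMap ℚ R (b.repr a.1 i) * ε * (ε * b i * ε) = _
      rw [← hε.1.2 (ε * algebraMap ℚ R _), ← hε.1.2 (ε * b i), ← mul_assoc ε ε, hε.1.1.eq,
        ← mul_assoc ε ε, hε.1.1.eq, ← Algebra.commutes, mul_assoc, ← mul_assoc ε ε, hε.1.1.eq,
        ← Algebra.smul_def, mul_smul_comm]
    rw [Finset.sum_congr rfl fun i _ => h1 i, ← Finset.mul_sum, b.sum_repr]
    exact (hε.1.mem_corner_iff.mp a.2).symm
  rw [ha]
  exact Submodule.sum_mem _ fun i _ => Submodule.smul_mem _ _ (Submodule.subset_span ⟨i, rfl⟩)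

/-- The dimension over the center of `ε R` of the right ideal generated by `ε f`. -/
def cornerRank {ε : R} (hε : IsIrredCentralIdem ε) (f : R) : ℕ :=
  Module.finrank (Subring.center hε.1.1.Corner) (LinearMap.range
    (LinearMap.mulLeft (Subring.center hε.1.1.Corner) (cornerMk hε f)))

/-- As `s ε = 1`, the representation factors through the simple corner at `ε`, where the central
simple computation applies. Since `cornerRank` does not mention `V`, all representations belonging
to `ε` give a rational idempotent the same trace; Galois conjugation and Schur indices are not
needed. -/
theorem finrank_eq_hdim_and_trace {V : Type*} [AddCommGroup V] [Module ℂ V]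
    [FiniteDimensional ℂ V] [Nontrivial V]
    [Algebra ℚ R] [FiniteDimensional ℚ R] [IsSemisimpleRing R] {ε : R}
    (hε : IsIrredCentralIdem ε) (s : R →+* Module.End ℂ V) (hsε : s ε = 1)
    (hs : Submodule.span ℂ (Set.range s) = ⊤) :
    hdim ε hε = Module.finrank ℂ V ∧ ∀ f : R, IsIdempotentElem f →
      (hdim ε hε : ℂ) * LinearMap.trace ℂ V (s f) = cornerRank hε f := by
  have hA := hε.isSimpleRing_corner
  have hfin := hε.finite_corner
  let : Field (Subring.center hε.1.1.Corner) :=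
    { (inferInstance : CommRing (Subring.center hε.1.1.Corner)),
      (IsSimpleRing.isField_center hε.1.1.Corner).toField with }
  have hc : Algebra.IsCentral (Subring.center hε.1.1.Corner) hε.1.1.Corner :=
    ⟨fun x hx => ⟨⟨x, Subring.mem_center_iff.mpr (Subalgebra.mem_center_iff.mp hx)⟩, rfl⟩⟩
  let s' : hε.1.1.Corner →+* Module.End ℂ V :=
    { toFun := fun a => s a.1
      map_one' := hsε
      map_mul' := fun a b => s.map_mul a.1 b.1
      map_zero' := s.map_zero
      map_add' := fun a b => s.map_add a.1 b.1 }
  have hval : ∀ r, s (ε * r * ε) = s r := fun r => by simp [hsε]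
  have hs' : Submodule.span ℂ (Set.range s') = ⊤ := by
    rw [eq_top_iff, ← hs, Submodule.span_le]
    rintro _ ⟨r, rfl⟩
    exact Submodule.subset_span ⟨cornerMk hε r, hval r⟩
  obtain ⟨h1, h2⟩ := finrank_eq_and_trace_of_span_eq_top (Subring.center hε.1.1.Corner) s' hs'
  have h3 : hdim ε hε = Module.finrank ℂ V := by
    unfold hdim
    rw [h1, Nat.sqrt_eq']
  refine ⟨h3, fun f hf => ?_⟩
  have h4 := h2 (cornerMk hε f) (Subtype.ext (by
    change ε * f * ε * (ε * f * ε) = ε * f * ε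
    rw [← hε.1.2 (ε * f), ← mul_assoc ε ε, hε.1.1.eq, mul_assoc ε f, ← mul_assoc f ε, ← hε.1.2 f,
      ← mul_assoc ε, ← mul_assoc ε, hε.1.1.eq, mul_assoc ε f, hf.eq]))
  rw [h3, ← hval f]
  exact h4

end Corner

/-! ### Inner products, absolute irreducibility and Frobenius reciprocity -/

section InnerProduct

variable {X : Type*} [Fintype X]

theorem cinner_comm (a b : X → ℂ) : cinner a b = (starRingEnd ℂ) (cinner b a) := by
  simp [cinner, mul_comm]

theorem cinner_sub_right (a b c : X → ℂ) : cinner a (b - c) = cinner a b - cinner a c := by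
  simp [cinner, mul_sub, Finset.sum_sub_distrib]

theorem cinner_sum_right {ι : Type*} (s : Finset ι) (a : X → ℂ) (b : ι → X → ℂ) :
    cinner a (fun g => ∑ i ∈ s, b i g) = ∑ i ∈ s, cinner a (b i) := by
  simp only [cinner, map_sum, Finset.mul_sum]
  rw [Finset.sum_comm]

end InnerProduct

section Characters

variable {G : Type*} [Group G]

/-- The extension of a complex representation to the rational group algebra. -/
def ratHom {m : ℕ} (σ : Representation ℂ G (Fin m → ℂ)) :
    MonoidAlgebra ℚ G →ₐ[ℚ] Module.End ℂ (Fin m → ℂ) :=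
  MonoidAlgebra.lift ℚ _ G σ

theorem ratHom_of {m : ℕ} (σ : Representation ℂ G (Fin m → ℂ)) (g : G) :
    ratHom σ (MonoidAlgebra.of ℚ G g) = σ g :=
  MonoidAlgebra.lift_of _ _

/-- The complex representation `σ` is absolutely irreducible (its operators span all
endomorphisms), and `ε` acts as the identity. -/
structure BelongsTo {m : ℕ} (σ : Representation ℂ G (Fin m → ℂ)) (ε : MonoidAlgebra ℚ G) :
    Prop where
  ne_zero : m ≠ 0
  span_eq_top : Submodule.span ℂ (Set.range σ) = ⊤
  map_eq_one : ratHom σ ε = 1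

/-- Burnside's theorem. -/
theorem span_range_eq_top_of_isIrreducible {V : Type*} [AddCommGroup V] [Module ℂ V]
    [FiniteDimensional ℂ V] (σ : Representation ℂ G V) (hσ : σ.IsIrreducible) :
    Submodule.span ℂ (Set.range σ) = ⊤ := by
  classical
  have hsimple := (Representation.irreducible_iff_isSimpleModule_asModule σ).mp hσ
  rw [eq_top_iff]
  intro T _
  have hfin : FiniteDimensional ℂ σ.asModule := inferInstanceAs (FiniteDimensional ℂ V)
  let T₀ : Module.End ℂ σ.asModule :=
    σ.asModuleEquiv.symm.toLinearMap ∘ₗ T ∘ₗ σ.asModuleEquiv.toLinearMap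
  -- By Schur's lemma the module endomorphisms are scalars, so any `T` commutes with them and
  -- density applies.
  let T' : Module.End (Module.End (MonoidAlgebra ℂ G) σ.asModule) σ.asModule :=
    { toFun := T₀
      map_add' := T₀.map_add
      map_smul' := fun φ x => by
        obtain ⟨c, rfl⟩ := (IsSimpleModule.algebraMap_end_bijective_of_isAlgClosed
          (A := MonoidAlgebra ℂ G) (V := σ.asModule) ℂ).2 φ
        exact T₀.map_smul c x }
  let b := Module.finBasis ℂ σ.asModule
  obtain ⟨r, hr⟩ := jacobson_density (R := MonoidAlgebra ℂ G) T' (Finset.univ.image b)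
  have hT : T = σ.asAlgebraHom r := by
    refine (b.map σ.asModuleEquiv).ext fun i => ?_
    have h := hr (b i) (by simp)
    rw [Module.Basis.map_apply, ← σ.asModuleEquiv_map_smul, ← h]
    simp [T', T₀]
  rw [hT, σ.asAlgebraHom_def, MonoidAlgebra.lift_apply]
  exact Submodule.sum_mem _ fun g _ => Submodule.smul_mem _ _ (Submodule.subset_span ⟨g, rfl⟩)

theorem span_range_ratHom {m : ℕ} (σ : Representation ℂ G (Fin m → ℂ))
    (h : Submodule.span ℂ (Set.range σ) = ⊤) : Submodule.span ℂ (Set.range (ratHom σ)) = ⊤ := by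
  rw [eq_top_iff, ← h, Submodule.span_le]
  rintro _ ⟨g, rfl⟩
  exact Submodule.subset_span ⟨_, ratHom_of σ g⟩

theorem commute_of_span_eq_top {m : ℕ} {σ : Representation ℂ G (Fin m → ℂ)}
    (h : Submodule.span ℂ (Set.range σ) = ⊤) (T : Module.End ℂ (Fin m → ℂ))
    (hT : ∀ g, σ g * T = T * σ g) : ∃ c : ℂ, T = algebraMap ℂ _ c := by
  refine Algebra.IsCentral.mem_center_iff (K := ℂ) |>.mp (Subalgebra.mem_center_iff.mpr fun U => ?_)
  have hU : U ∈ Submodule.span ℂ (Set.range σ) := h ▸ Submodule.mem_top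
  induction hU using Submodule.span_induction with
  | mem U hU =>
    obtain ⟨g, rfl⟩ := hU
    exact hT g
  | zero => simp
  | add U U' _ _ h h' => rw [add_mul, mul_add, h, h']
  | smul c U _ h => rw [smul_mul_assoc, mul_smul_comm, h]

/-- Absorbs the ambiguity of decomposition groups, which are defined only up to conjugation. -/
theorem indUnit_conj (H : Subgroup G) (g : G) :
    indUnit (H.map (MulAut.conj g).toMonoidHom) = indUnit H := by
  funext y
  have h1 : Nat.card (H.map (MulAut.conj g).toMonoidHom) = Nat.card H :=
    Nat.card_congr (H.equivMapOfInjective _ (MulAut.conj g).injective).symm.toEquiv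
  unfold indUnit
  rw [h1]
  congr 2
  refine Nat.card_congr (Equiv.subtypeEquiv (Equiv.mulRight g) fun x => ?_)
  rw [Subgroup.mem_map]
  constructor
  · rintro ⟨h, hh, he⟩
    have : h = g⁻¹ * (x⁻¹ * y * x) * g := by
      rw [← he]; simp [mul_assoc]
    simpa [mul_assoc, this] using hh
  · intro h
    exact ⟨_, h, by simp [mul_assoc]⟩

variable [Fintype G]

instance : FiniteDimensional ℚ (MonoidAlgebra ℚ G) :=
  Module.Finite.equiv (MonoidAlgebra.coeffLinearEquiv ℚ (S := ℚ) (M := G)).symm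

theorem BelongsTo.hdim_eq_and_trace {m : ℕ} {σ : Representation ℂ G (Fin m → ℂ)}
    {ε : MonoidAlgebra ℚ G} (h : BelongsTo σ ε) (hε : IsIrredCentralIdem ε) :
    hdim ε hε = m ∧ ∀ f : MonoidAlgebra ℚ G, IsIdempotentElem f →
      (hdim ε hε : ℂ) * LinearMap.trace ℂ _ (ratHom σ f) = cornerRank hε f := by
  have : NeZero m := ⟨h.ne_zero⟩
  have h1 := finrank_eq_hdim_and_trace hε (ratHom σ).toRingHom h.map_eq_one
    (span_range_ratHom σ h.span_eq_top)
  rw [Module.finrank_fin_fun] at h1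
  exact h1

/-- The trace of a rational idempotent depends only on the rational irreducible character. -/
theorem BelongsTo.trace_eq {m m' : ℕ} {σ : Representation ℂ G (Fin m → ℂ)}
    {σ' : Representation ℂ G (Fin m' → ℂ)} {ε : MonoidAlgebra ℚ G} (hε : IsIrredCentralIdem ε)
    (h : BelongsTo σ ε) (h' : BelongsTo σ' ε) {f : MonoidAlgebra ℚ G} (hf : IsIdempotentElem f) :
    LinearMap.trace ℂ _ (ratHom σ f) = LinearMap.trace ℂ _ (ratHom σ' f) := by
  have h0 : (hdim ε hε : ℂ) ≠ 0 := by
    rw [(h.hdim_eq_and_trace hε).1]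
    exact_mod_cast h.ne_zero
  exact mul_left_cancel₀ h0 (((h.hdim_eq_and_trace hε).2 f hf).trans
    ((h'.hdim_eq_and_trace hε).2 f hf).symm)

open Classical in
theorem indUnit_eq_sum (H : Subgroup G) (g : G) :
    indUnit H g = (Nat.card H : ℂ)⁻¹ * ∑ x : G, ∑ h : H, if g = x * h * x⁻¹ then 1 else 0 := by
  unfold indUnit
  congr 1
  rw [Nat.card_eq_fintype_card, Fintype.card_subtype, Finset.card_filter]
  push_cast
  refine Finset.sum_congr rfl fun x _ => ?_
  split_ifs with hx
  · rw [Finset.sum_eq_single ⟨_, hx⟩]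
    · simp [mul_assoc]
    · intro h _ hne
      rw [if_neg]
      rintro rfl
      exact hne (Subtype.ext (by simp [mul_assoc]))
    · simp
  · rw [Finset.sum_eq_zero]
    intro h _
    rw [if_neg]
    rintro rfl
    exact hx (by simp [mul_assoc])

/-- Frobenius reciprocity for the unit character. -/
theorem cinner_character_indUnit {m : ℕ} (σ : Representation ℂ G (Fin m → ℂ)) (H : Subgroup G) :
    cinner σ.character (indUnit H) = LinearMap.trace ℂ _ (ratHom σ (avg H)) := by
  classical
  have h0 : (Nat.card G : ℂ) ≠ 0 := by exact_mod_cast Nat.card_pos.ne'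
  -- After unfolding the induced character as a sum over pairs `(x, h)`, the summand no longer
  -- depends on `x`, so the sum over `x` cancels the factor `|G|⁻¹`.
  have h1 : ∑ g, σ.character g * (starRingEnd ℂ) (indUnit H g) =
      (Nat.card H : ℂ)⁻¹ * ∑ x : G, ∑ h : H, σ.character (x * h * x⁻¹) := by
    simp only [indUnit_eq_sum, map_mul, map_inv₀, map_natCast, map_sum, apply_ite (starRingEnd ℂ),
      map_one, map_zero]
    simp_rw [mul_left_comm _ ((Nat.card H : ℂ)⁻¹), ← Finset.mul_sum]
    congr 1
    simp_rw [Finset.mul_sum]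
    rw [Finset.sum_comm]
    refine Finset.sum_congr rfl fun x _ => ?_
    rw [Finset.sum_comm]
    simp
  rw [cinner, h1]
  simp only [Representation.char_conj, Finset.sum_const, Finset.card_univ,
    ← Nat.card_eq_fintype_card, nsmul_eq_mul]
  rw [mul_left_comm, inv_mul_cancel_left₀ h0]
  simp only [avg, map_smul, map_sum, ratHom_of]
  rw [← algebraMap_smul ℂ ((Nat.card H : ℚ)⁻¹), map_smul, map_sum, smul_eq_mul]
  simp [Representation.character]

/-- Writing `1` as induced from the whole group puts every character in the rank into the form
covered by Frobenius reciprocity. -/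
theorem augChar_eq (H : Subgroup G) : augChar H = indUnit H - indUnit (⊤ : Subgroup G) := by
  funext g
  have : Nat.card {x : G // x⁻¹ * g * x ∈ (⊤ : Subgroup G)} = Nat.card G :=
    Nat.card_congr (Equiv.subtypeUnivEquiv fun _ => Subgroup.mem_top _)
  simp [augChar, indUnit]

end Characters

/-! ### The involution of the group algebra -/

section Involution

variable {G : Type*} [Group G]

/-- The involution `g ↦ g⁻¹` of the rational group algebra. -/
def bar (x : MonoidAlgebra ℚ G) : MonoidAlgebra ℚ G := MonoidAlgebra.mapDomain (fun g => g⁻¹) x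

theorem coeff_bar (x : MonoidAlgebra ℚ G) (g : G) : (bar x).coeff g = x.coeff g⁻¹ := by
  have := Finsupp.mapDomain_apply (inv_injective (G := G)) x.coeff g⁻¹
  rwa [inv_inv] at this

theorem bar_bar (x : MonoidAlgebra ℚ G) : bar (bar x) = x := by
  ext g
  simp [coeff_bar]

variable [Fintype G]

theorem coeff_mul_eq_sum (x y : MonoidAlgebra ℚ G) (g : G) :
    (x * y).coeff g = ∑ t : G, x.coeff t * y.coeff (t⁻¹ * g) := by
  rw [MonoidAlgebra.coeff_mul_apply_left, Finsupp.sum_fintype _ _ (by simp)]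

theorem bar_mul (x y : MonoidAlgebra ℚ G) : bar (x * y) = bar y * bar x := by
  ext g
  rw [coeff_bar, coeff_mul_eq_sum, coeff_mul_eq_sum]
  refine Fintype.sum_equiv ((Equiv.mulLeft g).trans (Equiv.refl G)) _ _ fun t => ?_
  simp [coeff_bar, mul_comm]

theorem IsCentralIdem.bar {ε : MonoidAlgebra ℚ G} (h : IsCentralIdem ε) :
    IsCentralIdem (bar ε) := by
  refine ⟨?_, fun x => ?_⟩
  · rw [IsIdempotentElem, ← bar_mul, h.1.eq]
  · rw [← bar_bar x, ← bar_mul, ← bar_mul, h.2]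

/-- The coefficient of `x * bar x` at `1` is the sum of the squares of the coefficients of `x`. -/
theorem mul_bar_ne_zero {x : MonoidAlgebra ℚ G} (hx : x ≠ 0) : x * bar x ≠ 0 := by
  intro h
  apply hx
  have h1 : ∑ t : G, x.coeff t * x.coeff t = 0 := by
    have := congrArg (fun y => y.coeff 1) h
    simpa [coeff_mul_eq_sum, coeff_bar] using this
  ext g
  have := (Finset.sum_eq_zero_iff_of_nonneg fun t _ => mul_self_nonneg (x.coeff t)).mp h1 g
    (Finset.mem_univ g)
  simpa using this

theorem IsIrredCentralIdem.bar_eq {ε : MonoidAlgebra ℚ G} (hε : IsIrredCentralIdem ε) :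
    bar ε = ε := by
  have h : ε * bar ε = ε :=
    (hε.2.2 _ (IsCentralIdem.bar hε.1)).resolve_left (mul_bar_ne_zero hε.2.1)
  conv_lhs => rw [← h, bar_mul, bar_bar, h]

end Involution

/-! ### Characters belonging to an irreducible central idempotent -/

section Characters

variable {G : Type*} [Group G] [Fintype G]

theorem ratHom_eq_sum {m : ℕ} (σ : Representation ℂ G (Fin m → ℂ)) (x : MonoidAlgebra ℚ G) :
    ratHom σ x = ∑ g, (x.coeff g : ℂ) • σ g := by
  rw [ratHom, MonoidAlgebra.lift_apply, Finsupp.sum_fintype _ _ (by simp)]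
  refine Finset.sum_congr rfl fun g _ => ?_
  rw [← algebraMap_smul ℂ (x.coeff g)]
  rfl

/-- Inserting `ε` into the character of `ρ` and reindexing moves it to `σ` as `bar ε`, which is `ε`
again and acts as zero. -/
theorem cinner_eq_zero_of_ratHom_eq_zero {m n : ℕ} (σ : Representation ℂ G (Fin m → ℂ))
    (ρ : Representation ℚ G (Fin n → ℚ)) {ε : MonoidAlgebra ℚ G} (hε : IsIrredCentralIdem ε)
    (hρ : ρ.asAlgebraHom ε = 1) (hσ : ratHom σ ε = 0) :
    cinner σ.character (fun g => ((ρ.character g : ℚ) : ℂ)) = 0 := by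
  have h1 : ∀ g, ρ.character g = ∑ h, ε.coeff h * ρ.character (g * h) := by
    intro g
    have : ρ g = ∑ h, ε.coeff h • ρ (g * h) := by
      conv_lhs => rw [← mul_one (ρ g), ← hρ, ρ.asAlgebraHom_def, MonoidAlgebra.lift_apply,
        Finsupp.sum_fintype _ _ (by simp), Finset.mul_sum]
      simp
    simp only [Representation.character]
    conv_lhs => rw [this]
    simp
  have h2 : ∀ k, ∑ h, (ε.coeff h : ℂ) * σ.character (k * h⁻¹) = 0 := by
    intro k
    have : σ k * ratHom σ (bar ε) = 0 := by rw [hε.bar_eq, hσ, mul_zero]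
    have h3 := congrArg (LinearMap.trace ℂ (Fin m → ℂ)) this
    rw [ratHom_eq_sum, Finset.mul_sum, map_sum, map_zero] at h3
    rw [← h3]
    refine Fintype.sum_equiv (Equiv.inv G) _ _ fun h => ?_
    simp [coeff_bar, Representation.character]
  have h3 : ∑ g, σ.character g * ((ρ.character g : ℚ) : ℂ) = 0 := by
    calc _ = ∑ g, ∑ h, (ε.coeff h : ℂ) * σ.character g * ((ρ.character (g * h) : ℚ) : ℂ) := by
          refine Finset.sum_congr rfl fun g _ => ?_
          rw [h1 g]
          push_cast
          rw [Finset.mul_sum]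
          exact Finset.sum_congr rfl fun h _ => by ring
      _ = ∑ h, ∑ k, (ε.coeff h : ℂ) * σ.character (k * h⁻¹) * ((ρ.character k : ℚ) : ℂ) := by
          rw [Finset.sum_comm]
          refine Finset.sum_congr rfl fun h _ => ?_
          refine Fintype.sum_equiv (Equiv.mulRight h) _ _ fun g => ?_
          simp
      _ = 0 := by
          rw [Finset.sum_comm]
          refine Finset.sum_eq_zero fun k _ => ?_
          rw [← Finset.sum_mul, h2, zero_mul]
  unfold cinner
  simp only [map_ratCast]
  rw [h3, mul_zero]

/-- By Schur, `ε` acts on `σ` as an idempotent scalar; the value `0` would make the inner product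
vanish. -/
theorem IsAbsIrrCharIn.exists_belongsTo {ε : MonoidAlgebra ℚ G} (hε : IsIrredCentralIdem ε)
    {φ : G → ℂ} (h : IsAbsIrrCharIn ε φ) :
    ∃ (m : ℕ) (σ : Representation ℂ G (Fin m → ℂ)), BelongsTo σ ε ∧ φ = σ.character := by
  obtain ⟨n, ρ, m, σ, hρ, hρε, hσ, hφ, hne⟩ := h
  obtain rfl : φ = σ.character := funext hφ
  have hspan := span_range_eq_top_of_isIrreducible σ hσ
  have hm : m ≠ 0 := by
    rintro rfl
    have := (Representation.irreducible_iff_isSimpleModule_asModule σ).mp hσ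
    have := IsSimpleModule.nontrivial (MonoidAlgebra ℂ G) σ.asModule
    exact not_subsingleton σ.asModule (inferInstanceAs (Subsingleton (Fin 0 → ℂ)))
  refine ⟨m, σ, ⟨hm, hspan, ?_⟩, rfl⟩
  obtain ⟨c, hc⟩ := commute_of_span_eq_top hspan (ratHom σ ε) fun g => by
    rw [← ratHom_of, ← map_mul, ← map_mul, hε.1.2]
  have : NeZero m := ⟨hm⟩
  have hcc : c * c = c := by
    apply FaithfulSMul.algebraMap_injective ℂ (Module.End ℂ (Fin m → ℂ))
    rw [map_mul, ← hc, ← map_mul, hε.1.1.eq]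
  have hc0 : c ≠ 0 := by
    rintro rfl
    exact hne (cinner_eq_zero_of_ratHom_eq_zero σ ρ hε hρε (by rw [hc, map_zero]))
  rw [hc, mul_left_cancel₀ hc0 (hcc.trans (mul_one c).symm), map_one]

end Characters

/-! ### Inflation and deflation -/

section Deflation

variable {G : Type*} [Group G] {E : Type*} [Group E]

/-- The extension of `π` to group algebras, a left inverse of `inflation`. -/
abbrev deflation (π : E →* G) : MonoidAlgebra ℚ E →ₐ[ℚ] MonoidAlgebra ℚ G :=
  MonoidAlgebra.mapDomainAlgHom ℚ ℚ π

theorem deflation_of (π : E →* G) (s : E) :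
    deflation π (MonoidAlgebra.of ℚ E s) = MonoidAlgebra.of ℚ G (π s) := by
  simp [deflation, MonoidAlgebra.of]

theorem deflation_surjective {π : E →* G} (hπ : Function.Surjective π) :
    Function.Surjective (deflation π) := by
  intro x
  induction x using MonoidAlgebra.induction_on with
  | of g =>
    obtain ⟨s, rfl⟩ := hπ g
    exact ⟨_, deflation_of π s⟩
  | add x y hx hy =>
    obtain ⟨⟨a, rfl⟩, ⟨b, rfl⟩⟩ := And.intro hx hy
    exact ⟨a + b, map_add _ _ _⟩
  | smul c x hx =>
    obtain ⟨a, rfl⟩ := hx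
    exact ⟨c • a, map_smul _ _ _⟩

variable [Fintype G] [Fintype E]

theorem coeff_avg (H : Subgroup G) (g : G) : open Classical in
    (avg H).coeff g = if g ∈ H then (Nat.card H : ℚ)⁻¹ else 0 := by
  classical
  simp only [avg, MonoidAlgebra.coeff_smul, MonoidAlgebra.coeff_sum, Finsupp.smul_apply,
    Finsupp.finsetSum_apply, MonoidAlgebra.of_apply, MonoidAlgebra.coeff_single,
    Finsupp.single_apply]
  split_ifs with h
  · rw [Finset.sum_eq_single (⟨g, h⟩ : H)
      (fun x _ hx => if_neg fun h' : (x : G) = g => hx (Subtype.ext h')) (by simp)]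
    simp
  · rw [Finset.sum_eq_zero fun (x : H) _ => if_neg fun h' : (x : G) = g => h (h' ▸ x.2), smul_zero]

theorem avg_mul_of (H : Subgroup G) {h : G} (hh : h ∈ H) :
    avg H * MonoidAlgebra.of ℚ G h = avg H := by
  classical
  ext g
  rw [MonoidAlgebra.of_apply, MonoidAlgebra.coeff_mul_single_apply, coeff_avg, coeff_avg, mul_one]
  simp [H.mul_mem_cancel_right (H.inv_mem hh)]

/-- The product `avg (π H) * deflation (avg H)` equals either factor, because each absorbs the
other; no fibres need to be counted. -/
theorem deflation_avg (π : E →* G) (H : Subgroup E) :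
    deflation π (avg H) = avg (H.map π) := by
  classical
  have h1 : avg (H.map π) * deflation π (avg H) = deflation π (avg H) := by
    refine avg_mul_of_leftInv _ ?_
    rintro _ ⟨h, hh, rfl⟩
    rw [← deflation_of, ← map_mul, of_mul_avg H hh]
  have h0 : (Nat.card H : ℚ) ≠ 0 := by exact_mod_cast Nat.card_pos.ne'
  rw [← h1]
  conv_lhs => enter [2, 2]; unfold avg
  rw [map_smul, map_sum, mul_smul_comm, Finset.mul_sum, Finset.sum_congr rfl fun (h : H) _ =>
      (congrArg _ (deflation_of π h)).trans (avg_mul_of _ (Subgroup.mem_map_of_mem π h.2)),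
    Finset.sum_const, Finset.card_univ, ← Nat.card_eq_fintype_card, ← Nat.cast_smul_eq_nsmul ℚ,
    smul_smul, inv_mul_cancel₀ h0, one_smul]

variable (π : E →* G) (hπ : Function.Surjective π)

theorem coeff_inflation (x : MonoidAlgebra ℚ G) (s : E) :
    (inflation π hπ x).coeff s = (Nat.card π.ker : ℚ)⁻¹ * x.coeff (π s) := by
  change ((Nat.card π.ker : ℚ)⁻¹ • cosetSum π x).coeff s = _
  rw [MonoidAlgebra.coeff_smul, Finsupp.smul_apply, coeff_cosetSum, smul_eq_mul]

/-- The projection formula: the image of inflation is an ideal on which `ℚ[E]` acts through `ℚ[G]`.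
-/
theorem inflation_mul (x : MonoidAlgebra ℚ G) (y : MonoidAlgebra ℚ E) :
    inflation π hπ x * y = inflation π hπ (x * deflation π y) := by
  induction y using MonoidAlgebra.induction_on with
  | of s =>
    ext t
    rw [deflation_of, coeff_inflation, MonoidAlgebra.of_apply, MonoidAlgebra.of_apply,
      MonoidAlgebra.coeff_mul_single_apply, MonoidAlgebra.coeff_mul_single_apply, coeff_inflation]
    simp
  | add x y hx hy => rw [mul_add, map_add, mul_add, map_add, hx, hy]
  | smul c x hx => rw [mul_smul_comm, map_smul, mul_smul_comm, map_smul, hx]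

theorem mul_inflation (x : MonoidAlgebra ℚ G) (y : MonoidAlgebra ℚ E) :
    y * inflation π hπ x = inflation π hπ (deflation π y * x) := by
  induction y using MonoidAlgebra.induction_on with
  | of s =>
    ext t
    rw [deflation_of, coeff_inflation, MonoidAlgebra.of_apply, MonoidAlgebra.of_apply,
      MonoidAlgebra.coeff_single_mul_apply, MonoidAlgebra.coeff_single_mul_apply, coeff_inflation]
    simp
  | add x y hx hy => rw [add_mul, map_add, add_mul, map_add, hx, hy]
  | smul c x hx => rw [smul_mul_assoc, map_smul, smul_mul_assoc, map_smul, hx]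

theorem inflation_injective : Function.Injective (inflation π hπ) := by
  intro x y h
  have h0 : (Nat.card π.ker : ℚ)⁻¹ ≠ 0 := inv_ne_zero (by exact_mod_cast Nat.card_pos.ne')
  ext g
  obtain ⟨s, rfl⟩ := hπ g
  have := congrArg (fun z => z.coeff s) h
  simp only [coeff_inflation] at this
  exact mul_left_cancel₀ h0 this

theorem deflation_inflation (x : MonoidAlgebra ℚ G) : deflation π (inflation π hπ x) = x := by
  apply inflation_injective π hπ
  rw [← mul_one (deflation π _), ← mul_inflation, ← map_mul, mul_one]

theorem inflation_one : inflation π hπ 1 = avg π.ker := by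
  classical
  ext s
  rw [coeff_inflation, coeff_avg, MonoidAlgebra.one_def, MonoidAlgebra.coeff_single,
    Finsupp.single_apply]
  simp [MonoidHom.mem_ker, eq_comm]

theorem inflation_deflation (y : MonoidAlgebra ℚ E) :
    inflation π hπ (deflation π y) = inflation π hπ 1 * y := by
  rw [inflation_mul, one_mul]

theorem inflation_avg (H : Subgroup G) : inflation π hπ (avg H) = avg (H.comap π) := by
  rw [← Subgroup.map_comap_eq_self_of_surjective hπ H, ← deflation_avg, inflation_deflation,
    inflation_one, Subgroup.map_comap_eq_self_of_surjective hπ H]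
  exact avg_mul_of_leftInv _ fun τ hτ => of_mul_avg _ (Subgroup.ker_le_comap π H hτ)

end Deflation

/-! ### Correspondence of central idempotents -/

section CentralIdempotents

variable {G : Type*} [Group G] {E : Type*} [Group E]

theorem IsCentralIdem.map_deflation {π : E →* G} (hπ : Function.Surjective π)
    {f : MonoidAlgebra ℚ E} (hf : IsCentralIdem f) : IsCentralIdem (deflation π f) := by
  refine ⟨by rw [IsIdempotentElem, ← map_mul, hf.1.eq], fun x => ?_⟩
  obtain ⟨y, rfl⟩ := deflation_surjective hπ x
  rw [← map_mul, ← map_mul, hf.2]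

/-- The natural map from the left cosets of the preimage of `H` to those of `H`. -/
def cosetMap (π : E →* G) (H : Subgroup G) : E ⧸ H.comap π → G ⧸ H :=
  Quotient.map' π fun a b h => by
    rw [QuotientGroup.leftRel_apply] at h ⊢
    simpa using h

theorem cosetMap_bijective {π : E →* G} (hπ : Function.Surjective π) (H : Subgroup G) :
    Function.Bijective (cosetMap π H) := by
  constructor
  · intro a b
    induction a using QuotientGroup.induction_on with | H a =>
    induction b using QuotientGroup.induction_on with | H b =>
    intro h
    have h' : ((π a : G) : G ⧸ H) = (π b : G) := h
    rw [QuotientGroup.eq] at h' ⊢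
    simpa using h'
  · intro a
    induction a using QuotientGroup.induction_on with | H a =>
    obtain ⟨s, rfl⟩ := hπ a
    exact ⟨(s : E ⧸ H.comap π), rfl⟩

theorem mapDomain_cosetMap_asAlgebraHom (π : E →* G) (H : Subgroup G) (f : MonoidAlgebra ℚ E)
    (v : MonoidAlgebra ℚ (E ⧸ H.comap π)) :
    MonoidAlgebra.mapDomain (cosetMap π H)
        ((Representation.ofMulAction ℚ E (E ⧸ H.comap π)).asAlgebraHom f v) =
      (Representation.ofMulAction ℚ G (G ⧸ H)).asAlgebraHom (deflation π f)
        (MonoidAlgebra.mapDomain (cosetMap π H) v) := by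
  have hsmul : ∀ (c : ℚ) (w : MonoidAlgebra ℚ (E ⧸ H.comap π)),
      MonoidAlgebra.mapDomain (cosetMap π H) (c • w) =
        c • MonoidAlgebra.mapDomain (cosetMap π H) w := fun c w => by
    apply MonoidAlgebra.coeff_injective
    exact Finsupp.mapDomain_smul c w.coeff
  induction f using MonoidAlgebra.induction_on with
  | of s =>
    rw [deflation_of, Representation.asAlgebraHom_of, Representation.asAlgebraHom_of]
    induction v using MonoidAlgebra.induction_linear with
    | zero => simp
    | add v w hv hw => simp only [map_add, MonoidAlgebra.mapDomain_add, hv, hw]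
    | single a c =>
      rw [Representation.ofMulAction_single, MonoidAlgebra.mapDomain_single,
        MonoidAlgebra.mapDomain_single, Representation.ofMulAction_single]
      congr 1
      induction a using QuotientGroup.induction_on with | H a =>
      exact congrArg (QuotientGroup.mk) (map_mul π s a)
  | add x y hx hy => simp only [map_add, LinearMap.add_apply, MonoidAlgebra.mapDomain_add, hx, hy]
  | smul c x hx => simp only [map_smul, LinearMap.smul_apply, hsmul, hx]

/-- The map of coset spaces is a bijection, equivariant along `π`, and preserves coefficient sums.
-/
theorem actsTriviallyOnAug_comap_iff {π : E →* G} (hπ : Function.Surjective π) (H : Subgroup G)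
    (f : MonoidAlgebra ℚ E) :
    ActsTriviallyOnAug (H.comap π) f ↔ ActsTriviallyOnAug H (deflation π f) := by
  have hb := cosetMap_bijective hπ H
  have hinj : Function.Injective (MonoidAlgebra.mapDomain (R := ℚ) (cosetMap π H)) :=
    MonoidAlgebra.mapDomain_injective hb.1
  have hsum : ∀ v : MonoidAlgebra ℚ (E ⧸ H.comap π),
      ((MonoidAlgebra.mapDomain (cosetMap π H) v).coeff.sum fun _ a => a) =
        v.coeff.sum fun _ a => a := fun v =>
    Finsupp.sum_mapDomain_index (fun _ => rfl) fun _ _ _ => rfl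
  constructor
  · intro h v hv
    obtain ⟨w, rfl⟩ : ∃ w, MonoidAlgebra.mapDomain (cosetMap π H) w = v := by
      refine ⟨MonoidAlgebra.mapDomain (Equiv.ofBijective _ hb).symm v, ?_⟩
      apply MonoidAlgebra.coeff_injective
      change Finsupp.mapDomain _ (Finsupp.mapDomain _ _) = _
      rw [← Finsupp.mapDomain_comp]
      convert Finsupp.mapDomain_id
      funext x
      exact (Equiv.ofBijective _ hb).apply_symm_apply x
    rw [← mapDomain_cosetMap_asAlgebraHom, h w (by rwa [← hsum])]
  · intro h v hv
    apply hinj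
    rw [mapDomain_cosetMap_asAlgebraHom, h _ (by rwa [hsum])]

theorem IsAugIdem.unique {H : Subgroup G} {e e' : MonoidAlgebra ℚ G} (h : IsAugIdem H e)
    (h' : IsAugIdem H e') : e = e' := by
  rw [← h.2 e' h'.1.1 h'.1.2, h.1.1.2, h'.2 e h.1.1 h.1.2]

variable [Fintype G] [Fintype E] {π : E →* G} (hπ : Function.Surjective π)

theorem IsCentralIdem.map_inflation {f : MonoidAlgebra ℚ G} (hf : IsCentralIdem f) :
    IsCentralIdem (inflation π hπ f) := by
  refine ⟨by rw [IsIdempotentElem, ← map_mul, hf.1.eq], fun x => ?_⟩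
  rw [inflation_mul, mul_inflation, hf.2]

/-- Minimality carries over: if `f` acts trivially, so does `deflation π f`, and the projection
formula absorbs `f` into the inflated idempotent. -/
theorem inflation_augIdem (H : Subgroup G) :
    inflation π hπ (augIdem H) = augIdem (H.comap π) := by
  have h := augIdem_spec H
  refine IsAugIdem.unique ⟨⟨h.1.1.map_inflation hπ, ?_⟩, fun f hf hfa => ?_⟩ (augIdem_spec _)
  · rw [actsTriviallyOnAug_comap_iff hπ, deflation_inflation]
    exact h.1.2
  · rw [inflation_mul, h.2 _ (hf.map_deflation hπ) ((actsTriviallyOnAug_comap_iff hπ H f).mp hfa)]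

theorem IsIrredCentralIdem.map_inflation {ε : MonoidAlgebra ℚ G} (hε : IsIrredCentralIdem ε) :
    IsIrredCentralIdem (inflation π hπ ε) := by
  refine ⟨hε.1.map_inflation hπ,
    fun h => hε.2.1 (inflation_injective π hπ (h.trans (map_zero _).symm)),
    fun f hf => ?_⟩
  rw [inflation_mul]
  rcases hε.2.2 _ (hf.map_deflation hπ) with h | h
  · exact Or.inl (by rw [h, map_zero])
  · exact Or.inr (by rw [h])

/-- Such an `ε` lies in the ideal generated by `F(1)`, where inflation inverts deflation. -/
theorem inflation_deflation_of_mul_inflation {ε : MonoidAlgebra ℚ E} {e : MonoidAlgebra ℚ G}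
    (h : ε * inflation π hπ e = ε) : inflation π hπ (deflation π ε) = ε := by
  rw [inflation_deflation, ← h, mul_inflation, ← map_mul, one_mul]

theorem IsIrredCentralIdem.map_deflation {ε : MonoidAlgebra ℚ E} (hε : IsIrredCentralIdem ε)
    (h : inflation π hπ (deflation π ε) = ε) : IsIrredCentralIdem (deflation π ε) := by
  refine ⟨hε.1.map_deflation hπ, fun h' => hε.2.1 (by rw [← h, h', map_zero]), fun f hf => ?_⟩
  have key : deflation π ε * f = deflation π (ε * inflation π hπ f) := by
    rw [map_mul, deflation_inflation]
  rw [key]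
  rcases hε.2.2 _ (hf.map_inflation hπ) with h' | h'
  · exact Or.inl (by rw [h', map_zero])
  · exact Or.inr (by rw [h'])

/-- Inflation identifies the irreducible central idempotents contained in `e` and in its
inflation. -/
def compEquiv {e : MonoidAlgebra ℚ G} {e' : MonoidAlgebra ℚ E} (he : inflation π hπ e = e') :
    Comp e ≃ Comp e' where
  toFun ε := ⟨inflation π hπ ε.1, ε.2.1.map_inflation hπ, by rw [← he, ← map_mul, ε.2.2]⟩
  invFun ε :=
    have h := inflation_deflation_of_mul_inflation hπ (by rw [he]; exact ε.2.2)
    ⟨deflation π ε.1, ε.2.1.map_deflation hπ h, by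
      conv_lhs => rw [← deflation_inflation π hπ e, ← map_mul, he, ε.2.2]⟩
  left_inv ε := Subtype.ext (deflation_inflation π hπ _)
  right_inv ε := Subtype.ext (inflation_deflation_of_mul_inflation hπ (by rw [he]; exact ε.2.2))

/-- A representation of `E` belonging to an inflated idempotent is inflated from `G`. -/
theorem BelongsTo.exists_of_inflation {m : ℕ} {σ : Representation ℂ E (Fin m → ℂ)}
    {ε : MonoidAlgebra ℚ G} (h : BelongsTo σ (inflation π hπ ε)) :
    ∃ σ' : Representation ℂ G (Fin m → ℂ), BelongsTo σ' ε ∧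
      ∀ y, ratHom σ y = ratHom σ' (deflation π y) := by
  -- `F(1)` fixes `F(ε)`, which acts as the identity; this makes `σ ∘ F` unital.
  have h1 : ratHom σ (inflation π hπ 1) = 1 := by
    rw [← mul_one (ratHom σ _), ← h.map_eq_one, ← map_mul, ← map_mul, one_mul]
  let σ' : Representation ℂ G (Fin m → ℂ) :=
    { toFun := fun g => ratHom σ (inflation π hπ (MonoidAlgebra.of ℚ G g))
      map_one' := by rw [map_one, h1]
      map_mul' := fun a b => by rw [map_mul, map_mul, map_mul] }
  have h2 : ∀ x, ratHom σ' x = ratHom σ (inflation π hπ x) := by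
    intro x
    induction x using MonoidAlgebra.induction_on with
    | of g => exact ratHom_of σ' g
    | add x y hx hy => simp only [map_add, hx, hy]
    | smul c x hx => simp only [map_smul, hx]
  have h3 : ∀ y, ratHom σ y = ratHom σ' (deflation π y) := by
    intro y
    rw [h2, inflation_deflation, map_mul, h1, one_mul]
  refine ⟨σ', ⟨h.ne_zero, ?_, ?_⟩, h3⟩
  · rw [eq_top_iff, ← h.span_eq_top, Submodule.span_le]
    rintro _ ⟨s, rfl⟩
    refine Submodule.subset_span ⟨π s, ?_⟩
    rw [← ratHom_of σ', ← deflation_of, ← h3, ratHom_of]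
  · rw [h2, h.map_eq_one]

end CentralIdempotents

/-! ### Comparison of inner products and ranks -/

section Ranks

variable {G : Type*} [Group G] {E : Type*} [Group E] [Fintype G] [Fintype E] {π : E →* G}
  (hπ : Function.Surjective π)

/-- Here `σ'` need not be the inflation of `σ`. It descends to some `σ''` belonging to the same `ε`,
and `BelongsTo.trace_eq` replaces `σ''` by `σ`. -/
theorem BelongsTo.cinner_indUnit_eq {m m' : ℕ} {σ' : Representation ℂ E (Fin m' → ℂ)}
    {σ : Representation ℂ G (Fin m → ℂ)} {ε : MonoidAlgebra ℚ G} (hε : IsIrredCentralIdem ε)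
    (h' : BelongsTo σ' (inflation π hπ ε)) (h : BelongsTo σ ε) (H : Subgroup E) :
    cinner σ'.character (indUnit H) = cinner σ.character (indUnit (H.map π)) := by
  obtain ⟨σ'', h'', hσ⟩ := h'.exists_of_inflation hπ
  rw [cinner_character_indUnit, cinner_character_indUnit, hσ, deflation_avg,
    h''.trace_eq hε h (avg_isIdempotentElem _)]

theorem BelongsTo.hdim_inflation_eq {m : ℕ} {σ' : Representation ℂ E (Fin m → ℂ)}
    {ε : MonoidAlgebra ℚ G} (hε : IsIrredCentralIdem ε) (h' : BelongsTo σ' (inflation π hπ ε)) :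
    hdim (inflation π hπ ε) (hε.map_inflation hπ) = hdim ε hε := by
  obtain ⟨σ'', h'', -⟩ := h'.exists_of_inflation hπ
  rw [(h'.hdim_eq_and_trace _).1, (h''.hdim_eq_and_trace hε).1]

theorem BelongsTo.cinner_augChar_eq {m m' : ℕ} {σ' : Representation ℂ E (Fin m' → ℂ)}
    {σ : Representation ℂ G (Fin m → ℂ)} {ε : MonoidAlgebra ℚ G} (hε : IsIrredCentralIdem ε)
    (h' : BelongsTo σ' (inflation π hπ ε)) (h : BelongsTo σ ε) (H : Subgroup E) :
    cinner σ'.character (augChar H) = cinner σ.character (augChar (H.map π)) := by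
  rw [augChar_eq, augChar_eq, cinner_sub_right, cinner_sub_right, h'.cinner_indUnit_eq hπ hε h,
    h'.cinner_indUnit_eq hπ hε h, Subgroup.map_top_of_surjective π hπ]

theorem cinner_infChar (K₀ L : Type*) [Field K₀] [NumberField K₀] [Field L] [Algebra K₀ L]
    [FiniteDimensional K₀ L] (τ : Gal(L/K₀) ≃* G) (φ : G → ℂ) :
    cinner (infChar K₀ L τ) φ = (starRingEnd ℂ) (∑ v : NumberField.InfinitePlace K₀,
      cinner φ (indUnit (decompGroup K₀ L τ v)) - cinner φ (indUnit (⊤ : Subgroup G))) := by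
  rw [cinner_comm, ← cinner_sum_right, ← cinner_sub_right]
  congr 2
  funext g
  have h := congrFun (augChar_eq (⊤ : Subgroup G)) g
  have h1 : indUnit (⊤ : Subgroup G) g = 1 := by
    simp only [augChar, Pi.sub_apply, sub_self, sub_eq_zero] at h
    exact h
  rw [infChar, Pi.sub_apply, h1]
  ring

end Ranks

/-! ### Galois groups, infinite places and decomposition groups -/

section Fields

open NumberField

variable {K₀ K L M : Type*} [Field K₀] [Field K] [Field L] [Field M]
  [Algebra K₀ K] [Algebra K₀ L] [Algebra K₀ M] [Algebra K L] [Algebra K M] [Algebra L M]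
  [IsScalarTower K₀ K L] [IsScalarTower K₀ K M] [IsScalarTower K₀ L M] [IsScalarTower K L M]
  [Normal K₀ L]

theorem comap_smul_eq_restrictNormalHom_smul (g : Gal(M/K₀)) (w : InfinitePlace M) :
    (g • w).comap (algebraMap L M) =
      AlgEquiv.restrictNormalHom L g • w.comap (algebraMap L M) := by
  apply DFunLike.ext
  intro x
  rw [InfinitePlace.comap_apply, InfinitePlace.smul_apply, InfinitePlace.smul_apply,
    InfinitePlace.comap_apply]
  congr 1
  rw [← AlgEquiv.aut_inv, ← AlgEquiv.aut_inv, ← map_inv]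
  exact (AlgEquiv.restrictNormal_commutes g⁻¹ L x).symm

theorem map_stabilizer_restrictNormalHom [IsGalois K₀ M] (w : InfinitePlace M) :
    (MulAction.stabilizer Gal(M/K₀) w).map (AlgEquiv.restrictNormalHom L) =
      MulAction.stabilizer Gal(L/K₀) (w.comap (algebraMap L M)) := by
  have : IsGalois L M := IsGalois.tower_top_of_isGalois K₀ L M
  ext g
  rw [Subgroup.mem_map, MulAction.mem_stabilizer_iff]
  constructor
  · rintro ⟨h, hh, rfl⟩
    rw [← comap_smul_eq_restrictNormalHom_smul, MulAction.mem_stabilizer_iff.mp hh]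
  · intro hg
    obtain ⟨h, rfl⟩ := AlgEquiv.restrictNormalHom_surjective (F := K₀) (K₁ := L) M g
    rw [← comap_smul_eq_restrictNormalHom_smul] at hg
    -- `h • w` and `w` lie over the same place of `L`, so an element `k` of `Gal(M/L)` moves one to
    -- the other; `k * h` stabilizes `w` and has the same restriction as `h`.
    obtain ⟨k, hk⟩ := InfinitePlace.exists_smul_eq_of_comap_eq (k := L) hg
    refine ⟨(k.restrictScalars K₀) * h, ?_, ?_⟩
    · rw [MulAction.mem_stabilizer_iff, mul_smul]
      exact hk
    · rw [map_mul]
      convert one_mul _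
      ext x
      apply (algebraMap L M).injective
      rw [AlgEquiv.one_apply]
      exact (AlgEquiv.restrictNormal_commutes (k.restrictScalars K₀) L x).trans (k.commutes x)

variable {Γ Ξ : Type*} [Group Γ] [Group Ξ]

theorem galImage_comap_restrictHom [FiniteDimensional K₀ L] [FiniteDimensional K₀ M]
    [NumberField K₀] (τL : Gal(L/K₀) ≃* Γ) (τM : Gal(M/K₀) ≃* Ξ) :
    (galImage K₀ L K τL).comap (restrictHom τL τM) = galImage K₀ M K τM := by
  ext s
  obtain ⟨g, rfl⟩ := τM.surjective s
  have hmapL : ∀ h : Gal(L/K₀), τL h ∈ galImage K₀ L K τL ↔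
      h ∈ (IsScalarTower.toAlgHom K₀ K L).fieldRange.fixingSubgroup := fun h =>
    Subgroup.mem_map_iff_mem τL.injective
  have hmapM : τM g ∈ galImage K₀ M K τM ↔
      g ∈ (IsScalarTower.toAlgHom K₀ K M).fieldRange.fixingSubgroup :=
    Subgroup.mem_map_iff_mem τM.injective
  have hr : restrictHom τL τM (τM g) = τL (AlgEquiv.restrictNormalHom L g) := by
    simp [restrictHom]
  rw [Subgroup.mem_comap, hr, hmapL, hmapM, IntermediateField.mem_fixingSubgroup_iff,
    IntermediateField.mem_fixingSubgroup_iff]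
  have hc : ∀ x : L, algebraMap L M (AlgEquiv.restrictNormalHom L g x) = g (algebraMap L M x) :=
    fun x => AlgEquiv.restrictNormal_commutes g L x
  constructor
  · rintro h _ ⟨x, rfl⟩
    have := congrArg (algebraMap L M) (h _ ⟨x, rfl⟩)
    rw [hc] at this
    simpa [← IsScalarTower.algebraMap_apply] using this
  · rintro h _ ⟨x, rfl⟩
    apply (algebraMap L M).injective
    rw [hc]
    simpa [← IsScalarTower.algebraMap_apply] using h _ ⟨x, rfl⟩

/-- The places above `v` are chosen independently in `L` and `M`. The restriction to `L` of the one
in `M` is a Galois translate of the one in `L`, which accounts for the conjugation. -/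
theorem exists_conj_map_decompGroup [NumberField K₀] [FiniteDimensional K₀ L]
    [FiniteDimensional K₀ M] [IsGalois K₀ L] [IsGalois K₀ M]
    (τL : Gal(L/K₀) ≃* Γ) (τM : Gal(M/K₀) ≃* Ξ) (v : InfinitePlace K₀) :
    ∃ g : Γ, (decompGroup K₀ M τM v).map (restrictHom τL τM) =
      (decompGroup K₀ L τL v).map (MulAut.conj g).toMonoidHom := by
  have hL := (InfinitePlace.comap_surjective (k := K₀) (K := L) v).choose_spec
  have hM := (InfinitePlace.comap_surjective (k := K₀) (K := M) v).choose_spec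
  set wL := (InfinitePlace.comap_surjective (k := K₀) (K := L) v).choose with hwL
  set wM := (InfinitePlace.comap_surjective (k := K₀) (K := M) v).choose with hwM
  have hML : (wM.comap (algebraMap L M)).comap (algebraMap K₀ L) = v := by
    rw [← InfinitePlace.comap_comp, ← IsScalarTower.algebraMap_eq]
    exact hM
  obtain ⟨g, hg⟩ := InfinitePlace.exists_smul_eq_of_comap_eq (k := K₀) (hL.trans hML.symm)
  refine ⟨τL g, ?_⟩
  have h1 : (decompGroup K₀ M τM v).map (restrictHom τL τM) =
      (MulAction.stabilizer Gal(L/K₀) (wM.comap (algebraMap L M))).map τL.toMonoidHom := by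
    rw [← map_stabilizer_restrictNormalHom, decompGroup, Subgroup.map_map, Subgroup.map_map]
    congr 1
    ext x
    simp [restrictHom]
  rw [h1, ← hg, MulAction.stabilizer_smul_eq_stabilizer_map_conj, decompGroup, Subgroup.map_map,
    Subgroup.map_map]
  congr 1
  ext x
  simp

variable [NumberField K₀] [FiniteDimensional K₀ L] [FiniteDimensional K₀ M] [IsGalois K₀ L]
  [IsGalois K₀ M] [Fintype Γ] [Fintype Ξ]

theorem fixedRank_compEquiv (τL : Gal(L/K₀) ≃* Γ) (τM : Gal(M/K₀) ≃* Ξ) (Γ' : Subgroup Γ)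
    (Ξ' : Subgroup Ξ) (hΞ' : Ξ' = Γ'.comap (restrictHom τL τM))
    (he : inflation (restrictHom τL τM) (restrictHom_surjective τL τM) (augIdem Γ') = augIdem Ξ')
    (φ : Comp (augIdem Γ') → Γ → ℂ) (hφ : ∀ ε, IsAbsIrrCharIn ε.1 (φ ε))
    (ψ : Comp (augIdem Ξ') → Ξ → ℂ) (hψ : ∀ ε, IsAbsIrrCharIn ε.1 (ψ ε))
    (ε : Comp (augIdem Γ')) :
    fixedRank K₀ M τM Ξ' ψ (compEquiv (restrictHom_surjective τL τM) he ε) =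
      fixedRank K₀ L τL Γ' φ ε := by
  have hπ := restrictHom_surjective τL τM
  obtain ⟨m, σ, hσ, hφσ⟩ := (hφ ε).exists_belongsTo ε.2.1
  obtain ⟨m', σ', hσ', hψσ⟩ := (hψ (compEquiv hπ he ε)).exists_belongsTo
    (compEquiv hπ he ε).2.1
  have h1 := hσ'.cinner_augChar_eq hπ ε.2.1 hσ
  have h2 := hσ'.cinner_indUnit_eq hπ ε.2.1 hσ
  have h3 := hσ'.hdim_inflation_eq hπ ε.2.1
  unfold fixedRank galRank
  have h4 : Ξ'.map (restrictHom τL τM) = Γ' := by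
    rw [hΞ', Subgroup.map_comap_eq_self_of_surjective hπ]
  rw [hφσ, hψσ, h1, h1, Subgroup.map_bot, h4]
  congr 2
  · exact congrArg (fun n : ℕ => (n : ℂ)⁻¹) h3
  · rw [cinner_infChar, cinner_infChar, h2, Subgroup.map_top_of_surjective _ hπ]
    congr 2
    refine Finset.sum_congr rfl fun v _ => ?_
    obtain ⟨g, hg⟩ := exists_conj_map_decompGroup τL τM v
    rw [h2, hg, indUnit_conj]

end Fields

/-! ### Invertibility of the order of the kernel -/

section Integrality

theorem padicNorm_le_one_of_mem_ZS {p : Nat.Primes} {q : ℚ} (hq : q ∈ ZS {p}) :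
    padicNorm p q ≤ 1 := by
  have : Fact (p : ℕ).Prime := ⟨p.2⟩
  obtain ⟨a, b, hb, -, rfl⟩ := hq
  have hb1 : padicNorm p b = 1 := (padicNorm.int_eq_one_iff (p := p) b).mpr (hb p rfl)
  rw [padicNorm.div, hb1, div_one]
  exact padicNorm.of_int a

theorem coeff_mem_ZS_of_mem_groupRing {G : Type*} [Group G] {S : Set Nat.Primes}
    {x : MonoidAlgebra ℚ G} (hx : x ∈ groupRing S G) (g : G) : x.coeff g ∈ ZS S := by
  classical
  induction hx using Submodule.span_induction with
  | mem x hx =>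
    obtain ⟨h, rfl⟩ := hx
    rw [MonoidAlgebra.of_apply, MonoidAlgebra.coeff_single, Finsupp.single_apply]
    split_ifs
    exacts [(ZS S).one_mem, (ZS S).zero_mem]
  | zero => exact (ZS S).zero_mem
  | add x y _ _ hx hy => exact (ZS S).add_mem hx hy
  | smul c x _ hx => exact (ZS S).mul_mem c.2 hx

variable {G : Type*} [Group G] [Fintype G]

/-- An idempotent of `ℚ[G]` whose coefficients are divisible by `p` is zero. -/
theorem eq_zero_of_isIdempotentElem_of_padicNorm_lt_one {p : ℕ} [Fact p.Prime]
    {e : MonoidAlgebra ℚ G} (he : IsIdempotentElem e) (h : ∀ g, padicNorm p (e.coeff g) < 1) :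
    e = 0 := by
  obtain ⟨g, -, hg⟩ := Finset.exists_max_image Finset.univ (fun g => padicNorm p (e.coeff g))
    ⟨1, Finset.mem_univ _⟩
  -- With `N` the maximal norm of a coefficient, `e = e * e` and the ultrametric inequality give `N
  -- ≤ N * N`; as `N < 1`, this forces `N = 0`.
  have h1 : padicNorm p (e.coeff g) ≤ padicNorm p (e.coeff g) * padicNorm p (e.coeff g) := by
    conv_lhs => rw [← he.eq, coeff_mul_eq_sum]
    refine padicNorm.sum_le ⟨1, Finset.mem_univ _⟩ fun t _ => ?_
    rw [padicNorm.mul]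
    exact mul_le_mul (hg _ (Finset.mem_univ _)) (hg _ (Finset.mem_univ _)) (padicNorm.nonneg _)
      (padicNorm.nonneg _)
  have h2 : padicNorm p (e.coeff g) = 0 := by
    have := padicNorm.nonneg (p := p) (e.coeff g)
    nlinarith [h g]
  ext t
  have := hg t (Finset.mem_univ _)
  rw [h2] at this
  exact padicNorm.zero_of_padicNorm_eq_zero (le_antisymm this (padicNorm.nonneg _))

variable {E : Type*} [Group E] [Fintype E] (π : E →* G) (hπ : Function.Surjective π)

/-- A prime of `S` dividing `|ker π|` would divide every coefficient of `e`, these being `|ker π|`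
times integral coefficients of the inflation. -/
theorem inv_card_ker_mem_ZS {S : Set Nat.Primes} {e : MonoidAlgebra ℚ G}
    (he : IsIdempotentElem e) (h0 : e ≠ 0)
    (hS : ∀ p ∈ S, inflation π hπ e ∈ groupRing {p} E) : (Nat.card π.ker : ℚ)⁻¹ ∈ ZS S := by
  refine ⟨1, Nat.card π.ker, fun p hp hdvd => h0 ?_, by exact_mod_cast Nat.card_pos.ne', by simp⟩
  have : Fact (p : ℕ).Prime := ⟨p.2⟩
  refine eq_zero_of_isIdempotentElem_of_padicNorm_lt_one (p := p) he fun g => ?_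
  obtain ⟨s, rfl⟩ := hπ g
  have h1 := padicNorm_le_one_of_mem_ZS (coeff_mem_ZS_of_mem_groupRing (hS p hp) s)
  have h2 : padicNorm p ((Nat.card π.ker : ℤ) : ℚ) < 1 := (padicNorm.int_lt_one_iff _).mpr hdvd
  have hne : (Nat.card π.ker : ℚ) ≠ 0 := by exact_mod_cast Nat.card_pos.ne'
  have h3 : e.coeff (π s) = ((Nat.card π.ker : ℤ) : ℚ) * (inflation π hπ e).coeff s := by
    rw [coeff_inflation]
    push_cast
    rw [mul_inv_cancel_left₀ hne]
  rw [h3, padicNorm.mul]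
  have := padicNorm.nonneg (p := p) ((inflation π hπ e).coeff s)
  have := padicNorm.nonneg (p := p) ((Nat.card π.ker : ℤ) : ℚ)
  nlinarith

end Integrality

/-! ### Comparison of orders and of the rings `𝔬` -/

section Orders

variable {G : Type*} [Group G] [Fintype G] {E : Type*} [Group E] [Fintype E] {π : E →* G}
  {S : Set Nat.Primes}

/-- If `|ker π|` is invertible in `ℤ_S`, a maximal order containing the image of `O'` is the image
of `O'`. -/
theorem map_deflation_eq (hπ : Function.Surjective π) {O : ZSub S (MonoidAlgebra ℚ G)}
    {O' : ZSub S (MonoidAlgebra ℚ E)} (hO : IsMaximalOrder S 1 O) (hO' : IsOrder S 1 O')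
    (hc : ∀ x ∈ O, cosetSum π x ∈ O') (hu : (Nat.card π.ker : ℚ)⁻¹ ∈ ZS S) :
    O'.map ((deflation π).toLinearMap.restrictScalars (ZS S)) = O := by
  -- Dividing the coset sum by `|ker π|` stays in `O'` and gives `F(x)`, which deflates to `x`.
  have hle : O ≤ O'.map ((deflation π).toLinearMap.restrictScalars (ZS S)) := fun x hx =>
    ⟨inflation π hπ x, O'.smul_mem ⟨_, hu⟩ (hc x hx), deflation_inflation π hπ x⟩
  refine hO.2 _ ⟨fun x _ => ⟨one_mul x, mul_one x⟩, ⟨1, hO'.one_mem, map_one (deflation π)⟩, ?_,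
    hO'.fg.map _, fun x h1 h2 => Submodule.span_mono hle (hO.1.spans x h1 h2)⟩ hle
  rintro _ ⟨a, ha, rfl⟩ _ ⟨b, hb, rfl⟩
  exact ⟨a * b, hO'.mul_mem a ha b hb, map_mul (deflation π) a b⟩

variable (hπ : Function.Surjective π)

/-- `Λ'` is the image of `Λ` under inflation. -/
def IsInflated (Λ : ZSub S (MonoidAlgebra ℚ G)) (Λ' : ZSub S (MonoidAlgebra ℚ E)) : Prop :=
  ∀ y, y ∈ Λ' ↔ ∃ x ∈ Λ, inflation π hπ x = y

theorem isInflated_lmul {O : ZSub S (MonoidAlgebra ℚ G)} {O' : ZSub S (MonoidAlgebra ℚ E)}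
    (hO : IsMaximalOrder S 1 O) (hO' : IsOrder S 1 O') (hc : ∀ x ∈ O, cosetSum π x ∈ O')
    {e : MonoidAlgebra ℚ G} (he : IsIdempotentElem e)
    (hS : ∀ p ∈ S, inflation π hπ e ∈ groupRing {p} E) :
    IsInflated hπ (lmul e O) (lmul (inflation π hπ e) O') := by
  intro y
  -- When `e = 0`, integrality of its inflation says nothing about `|ker π|`, but both sides vanish.
  by_cases h0 : e = 0
  · subst h0
    constructor
    · rintro ⟨a, -, rfl⟩
      exact ⟨0, Submodule.zero_mem _, by simp⟩
    · rintro ⟨_, ⟨a, -, rfl⟩, rfl⟩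
      have : inflation π hπ ((0 : MonoidAlgebra ℚ G) * a) = 0 := by simp
      exact this ▸ Submodule.zero_mem _
  · have hm := map_deflation_eq hπ hO hO' hc (inv_card_ker_mem_ZS π hπ he h0 hS)
    constructor
    · rintro ⟨a, ha, rfl⟩
      exact ⟨e * deflation π a, ⟨deflation π a, hm ▸ ⟨a, ha, rfl⟩, rfl⟩,
        (inflation_mul π hπ e a).symm⟩
    · rintro ⟨_, ⟨x, hx, rfl⟩, rfl⟩
      obtain ⟨a, ha, rfl⟩ := hm.symm ▸ hx
      exact ⟨a, ha, inflation_mul π hπ e a⟩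

variable {hπ} {Λ : ZSub S (MonoidAlgebra ℚ G)} {Λ' : ZSub S (MonoidAlgebra ℚ E)}

theorem IsInflated.rmul (h : IsInflated hπ Λ Λ') (f : MonoidAlgebra ℚ G) :
    IsInflated hπ (rmul Λ f) (rmul Λ' (inflation π hπ f)) := by
  intro y
  constructor
  · rintro ⟨a, ha, rfl⟩
    obtain ⟨x, hx, rfl⟩ := (h a).mp ha
    exact ⟨x * f, ⟨x, hx, rfl⟩, map_mul _ x f⟩
  · rintro ⟨_, ⟨x, hx, rfl⟩, rfl⟩
    exact ⟨_, (h _).mpr ⟨x, hx, rfl⟩, (map_mul (inflation π hπ) x f).symm⟩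

theorem IsInflated.leftInv (h : IsInflated hπ Λ Λ') (H : Subgroup G) :
    IsInflated hπ (leftInv H Λ) (leftInv (H.comap π) Λ') := by
  intro y
  constructor
  · rintro ⟨hy, hinv⟩
    obtain ⟨x, hx, rfl⟩ := (h y).mp hy
    refine ⟨x, ⟨hx, fun τ hτ => inflation_injective π hπ ?_⟩, rfl⟩
    obtain ⟨s, rfl⟩ := hπ τ
    rw [← deflation_of, ← mul_inflation, hinv s hτ]
  · rintro ⟨x, ⟨hx, hinv⟩, rfl⟩
    refine ⟨(h _).mpr ⟨x, hx, rfl⟩, fun s hs => ?_⟩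
    rw [mul_inflation, deflation_of, hinv _ hs]

/-- Inflation as an isomorphism onto the inflated module. -/
def IsInflated.equiv (h : IsInflated hπ Λ Λ') : Λ ≃+ Λ' :=
  AddEquiv.ofBijective
    ({ toFun := fun x => ⟨inflation π hπ x, (h _).mpr ⟨x, x.2, rfl⟩⟩
       map_zero' := Subtype.ext (map_zero _)
       map_add' := fun x y => Subtype.ext (map_add _ _ _) } : Λ →+ Λ')
    ⟨fun x y hxy => Subtype.ext (inflation_injective π hπ (congrArg Subtype.val hxy)),
      fun y => by
        obtain ⟨x, hx, hxy⟩ := (h y).mp y.2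
        exact ⟨⟨x, hx⟩, Subtype.ext hxy⟩⟩

/-- Inflation as an isomorphism of the rings `𝔬`. -/
def heckeEquiv {H : Subgroup G} {H' : Subgroup E} {O : ZSub S (MonoidAlgebra ℚ G)}
    {O' : ZSub S (MonoidAlgebra ℚ E)} (hO : IsOrder S 1 O) (hO' : IsOrder S 1 O')
    (he : inflation π hπ (augIdem H) = augIdem H') (ha : inflation π hπ (avg H) = avg H')
    (h : IsInflated hπ (heckeModule H O) (heckeModule H' O')) :
    heckeRing H O hO ≃+* heckeRing H' O' hO' :=
  have hcorner : ∀ x : heckeRing H O hO, ∃ r, augIdem H' * avg H' * r * (augIdem H' * avg H') =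
      inflation π hπ (heckeVal x) := fun x => by
    obtain ⟨r, hr⟩ := x.1.2
    refine ⟨inflation π hπ r, ?_⟩
    rw [← he, ← ha, ← map_mul, ← map_mul, ← map_mul]
    exact congrArg _ hr
  RingEquiv.ofBijective
    ({ toFun := fun x => ⟨⟨inflation π hπ (heckeVal x), hcorner x⟩,
         (h _).mpr ⟨heckeVal x, x.2, rfl⟩⟩
       map_one' := Subtype.ext (Subtype.ext (by
         change inflation π hπ (augIdem H * avg H) = augIdem H' * avg H'
         rw [map_mul, he, ha]))
       map_mul' := fun x y => Subtype.ext (Subtype.ext (map_mul (inflation π hπ) _ _))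
       map_zero' := Subtype.ext (Subtype.ext (map_zero (inflation π hπ)))
       map_add' := fun x y => Subtype.ext (Subtype.ext (map_add (inflation π hπ) _ _)) } :
       heckeRing H O hO →+* heckeRing H' O' hO')
    ⟨fun x y hxy => Subtype.ext (Subtype.ext (inflation_injective π hπ
        (congrArg (fun z : heckeRing H' O' hO' => heckeVal z) hxy))),
      fun y => by
        obtain ⟨x, hx, hxy⟩ := (h (heckeVal y)).mp y.2
        -- The preimage must lie in the corner ring; its witness is the deflation of the witness for
        -- `y`.
        have hc : ∃ r, augIdem H * avg H * r * (augIdem H * avg H) = x := by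
          obtain ⟨r, hr⟩ := y.1.2
          change augIdem H' * avg H' * r * (augIdem H' * avg H') = heckeVal y at hr
          refine ⟨deflation π r, inflation_injective π hπ ?_⟩
          rw [hxy, ← deflation_inflation π hπ (augIdem H), ← deflation_inflation π hπ (avg H), he,
            ha, ← map_mul, ← map_mul, ← map_mul, inflation_deflation, hr]
          have h1 : inflation π hπ 1 * augIdem H' = augIdem H' := by rw [← he, ← map_mul, one_mul]
          rw [← hr]
          simp only [← mul_assoc, h1]
        exact ⟨⟨⟨x, hc⟩, hx⟩, Subtype.ext (Subtype.ext hxy)⟩⟩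

/-- A maximal order contains the central idempotents. -/
theorem IsMaximalOrder.mem_of_isCentralIdem {A : Type*} [Ring A] [Algebra ℚ A] {O : ZSub S A}
    (hO : IsMaximalOrder S 1 O) {ε : A} (hε : IsCentralIdem ε) : ε ∈ O := by
  -- `O + ε O` is again an order because `ε` is central and idempotent, so maximality puts `ε` in
  -- `O`.
  have hle : O ≤ O ⊔ lmul ε O := le_sup_left
  have hmem : ∀ x ∈ O, ∀ y ∈ O, x * y ∈ O := hO.1.mul_mem
  have hε' : ε * 1 ∈ O ⊔ lmul ε O := Submodule.mem_sup_right ⟨1, hO.1.one_mem, rfl⟩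
  rw [mul_one] at hε'
  rwa [hO.2 (O ⊔ lmul ε O) ⟨fun x _ => ⟨one_mul x, mul_one x⟩, hle hO.1.one_mem, ?_,
    hO.1.fg.sup (hO.1.fg.map _),
    fun x h1 h2 => Submodule.span_mono hle (hO.1.spans x h1 h2)⟩ hle] at hε'
  intro x hx y hy
  obtain ⟨a, ha, _, ⟨b, hb, rfl⟩, rfl⟩ := Submodule.mem_sup.mp hx
  obtain ⟨c, hc, _, ⟨d, hd, rfl⟩, rfl⟩ := Submodule.mem_sup.mp hy
  change (a + ε * b) * (c + ε * d) ∈ _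
  have : (a + ε * b) * (c + ε * d) = a * c + ε * (a * d + b * c + b * d) := by
    have h1 : a * (ε * d) = ε * (a * d) := by rw [← mul_assoc, ← hε.2, mul_assoc]
    have h2 : ε * b * (ε * d) = ε * (b * d) := by
      rw [hε.2 b, mul_assoc, ← mul_assoc ε, hε.1.eq, ← mul_assoc, ← hε.2, mul_assoc]
    rw [add_mul, mul_add, mul_add, h1, h2, mul_assoc, mul_add, mul_add]
    abel
  rw [this]
  exact Submodule.add_mem_sup (hmem a ha c hc)
    ⟨_, O.add_mem (O.add_mem (hmem a ha d hd) (hmem b hb c hc)) (hmem b hb d hd), rfl⟩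

end Orders

/-! ### Transport of modules and of probability laws -/

section Transport

open scoped ENNReal

/-- Probability distributions proportional to corresponding weights correspond. -/
theorem PMF.eq_of_mul_weight_eq {α β : Type*} (T : α ≃ β) (P : PMF α) (Q : PMF β)
    {w : α → ℝ≥0∞} {w' : β → ℝ≥0∞} (hw : ∀ a, w' (T a) = w a) (h0 : ∀ a, w a ≠ 0)
    (hfin : ∀ a, w a ≠ ⊤) (hP : ∀ a b, P a * w a = P b * w b)
    (hQ : ∀ a b, Q a * w' a = Q b * w' b) (a : α) : P a = Q (T a) := by
  -- The constant `R a * w a` is forced by total mass `1`: it is the inverse of the sum of the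
  -- inverse weights.
  have key : ∀ R : PMF α, (∀ a b, R a * w a = R b * w b) →
      R a * w a * ∑' b, (w b)⁻¹ = 1 := by
    intro R hR
    rw [← ENNReal.tsum_mul_left, ← R.tsum_coe]
    refine tsum_congr fun b => ?_
    rw [hR a b, mul_assoc, ENNReal.mul_inv_cancel (h0 b) (hfin b), mul_one]
  have h1 := key P hP
  have hT : ∀ b, (Q.map T.symm) b = Q (T b) := fun b => by
    rw [PMF.map_apply, tsum_eq_single (T b)]
    · simp
    · intro c hc
      rw [if_neg]
      rintro rfl
      simp at hc
  have h2 := key (Q.map T.symm) fun a b => by rw [hT, hT, ← hw, ← hw]; exact hQ _ _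
  rw [hT] at h2
  have hs0 : ∑' b, (w b)⁻¹ ≠ 0 := fun h => by simp [h] at h1
  have hst : ∑' b, (w b)⁻¹ ≠ ⊤ := fun h => by
    rw [h] at h1
    by_cases hz : P a * w a = 0
    · simp [hz] at h1
    · simp [ENNReal.mul_top hz] at h1
  exact (ENNReal.mul_left_inj (h0 a) (hfin a)).mp
    ((ENNReal.mul_left_inj hs0 hst).mp (h1.trans h2.symm))

variable {R R' : Type*} [Ring R] [Ring R'] (θ : R ≃+* R')

/-- Transport of a finite module along an isomorphism of rings. -/
def FinMod.transport (X : FinMod R) : FinMod R' :=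
  letI : Module R' X.carrier := Module.compHom X.carrier (θ.symm : R' →+* R)
  { carrier := X.carrier }

theorem FinMod.transport_equiv_iff (X : FinMod R) (Y : FinMod R') :
    FinMod.transport θ X ≈ Y ↔ ∃ f : X.carrier ≃+ Y.carrier, ∀ a x, f (a • x) = θ a • f x := by
  constructor
  · rintro ⟨g⟩
    refine ⟨g.toAddEquiv, fun a x => ?_⟩
    have h := g.map_smul (θ a) x
    have h1 : θ.symm (θ a) • x = a • x := by rw [θ.symm_apply_apply]
    exact (congrArg g h1).symm.trans h
  · rintro ⟨f, hf⟩
    exact ⟨{ f with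
      map_smul' := fun a x => by
        refine (hf (θ.symm a) x).trans ?_
        rw [θ.apply_symm_apply]
        rfl }⟩

/-- The bijection of isomorphism classes of finite modules induced by an isomorphism of rings. -/
def FinModClass.transport : FinModClass R ≃ FinModClass R' where
  toFun := Quotient.map (FinMod.transport θ) fun X Y ⟨g⟩ =>
    (FinMod.transport_equiv_iff θ X _).mpr ⟨g.toAddEquiv, fun a x => by
      change g (a • x) = (θ.symm (θ a) • g x : Y.carrier)
      rw [θ.symm_apply_apply, g.map_smul]⟩
  invFun := Quotient.map (FinMod.transport θ.symm) fun X Y ⟨g⟩ =>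
    (FinMod.transport_equiv_iff θ.symm X _).mpr ⟨g.toAddEquiv, fun a x => by
      change g (a • x) = (θ.symm.symm (θ.symm a) • g x : Y.carrier)
      rw [θ.symm.symm_apply_apply, g.map_smul]⟩
  left_inv := by
    rintro ⟨X⟩
    exact Quotient.sound ((FinMod.transport_equiv_iff θ.symm _ X).mpr
      ⟨AddEquiv.refl _, fun a x => rfl⟩)
  right_inv := by
    rintro ⟨X⟩
    exact Quotient.sound ((FinMod.transport_equiv_iff θ _ X).mpr ⟨AddEquiv.refl _, fun a x => rfl⟩)

variable {θ} in
-- Conjugation by `f` identifies the two automorphism groups.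
theorem card_aut_eq {X : FinMod R} {Y : FinMod R'} (f : X.carrier ≃+ Y.carrier)
    (hf : ∀ a x, f (a • x) = θ a • f x) :
    Nat.card (X.carrier ≃ₗ[R] X.carrier) = Nat.card (Y.carrier ≃ₗ[R'] Y.carrier) := by
  have hf' : ∀ a y, f.symm (a • y) = θ.symm a • f.symm y := fun a y => by
    rw [AddEquiv.symm_apply_eq, hf, θ.apply_symm_apply, f.apply_symm_apply]
  exact Nat.card_congr
    { toFun := fun g =>
        { (f.symm.trans g.toAddEquiv).trans f with
          map_smul' := fun a y => by
            change f (g (f.symm (a • y))) = a • f (g (f.symm y))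
            rw [hf', g.map_smul, hf, θ.apply_symm_apply] }
      invFun := fun g =>
        { (f.trans g.toAddEquiv).trans f.symm with
          map_smul' := fun a y => by
            change f.symm (g (f (a • y))) = a • f.symm (g (f y))
            rw [hf, g.map_smul, hf', θ.symm_apply_apply] }
      left_inv := fun g => by
        ext x
        change f.symm (f (g (f.symm (f x)))) = g x
        simp
      right_inv := fun g => by
        ext x
        change f (f.symm (g (f (f.symm x)))) = g x
        simp }

end Transport

/-! ### The predicted distributions -/

section Laws

variable {G : Type*} [Group G] [Fintype G] {S : Set Nat.Primes} {H : Subgroup G}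
  {O : ZSub S (MonoidAlgebra ℚ G)}

theorem exists_heckeVal_eq {hO : IsOrder S 1 O} (hmax : IsMaximalOrder S 1 O)
    (ε : Comp (augIdem H)) : ∃ a : heckeRing H O hO, heckeVal a = ε.1 * avg H := by
  have hε := ε.2.1.1
  have he := (augIdem_spec H).1.1
  have h1 : augIdem H * ε.1 = ε.1 := by rw [he.2, ε.2.2]
  have h2 : augIdem H * avg H * ε.1 * (augIdem H * avg H) = ε.1 * avg H := by
    rw [mul_assoc (augIdem H), ← hε.2, ← mul_assoc (augIdem H), h1, he.2 (avg H), ← mul_assoc,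
      mul_assoc ε.1, avg_isIdempotentElem H, mul_assoc, ← he.2, ← mul_assoc, ε.2.2]
  refine ⟨⟨⟨ε.1 * avg H, ε.1, h2⟩, ⟨⟨augIdem H * ε.1, ⟨ε.1, hmax.mem_of_isCentralIdem hε, rfl⟩,
    congrArg (· * avg H) h1⟩, fun τ hτ => ?_⟩⟩, rfl⟩
  rw [← mul_assoc, ← hε.2, mul_assoc, of_mul_avg H hτ]

/-- Each component contains `0`, because maximality puts `ε e₁'` into `𝔬`; otherwise `compPart`
could be empty. -/
theorem cardPow_pos {hO : IsOrder S 1 O} (hmax : IsMaximalOrder S 1 O)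
    (v : Comp (augIdem H) → ℂ) (X : FinMod (heckeRing H O hO)) : 0 < cardPow v X := by
  refine finprod_induction (fun x : ℝ => 0 < x) one_pos (fun _ _ => mul_pos) fun ε => ?_
  obtain ⟨a, ha⟩ := exists_heckeVal_eq (hO := hO) hmax ε
  refine Real.rpow_pos_of_pos ?_ _
  have hne : (compPart ε X).Nonempty := ⟨0, a, ha, 0, (smul_zero a).symm⟩
  exact_mod_cast (Set.ncard_pos (Set.toFinite _)).mpr hne

/-- The inverse of the relative probability of `X`. -/
def moduleWeight {hO : IsOrder S 1 O} (v : Comp (augIdem H) → ℂ)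
    (X : FinMod (heckeRing H O hO)) : ENNReal :=
  ENNReal.ofReal (cardPow v X * Nat.card (X.carrier ≃ₗ[heckeRing H O hO] X.carrier))

theorem moduleWeight_ne_zero {hO : IsOrder S 1 O} (hmax : IsMaximalOrder S 1 O)
    (v : Comp (augIdem H) → ℂ) (X : FinMod (heckeRing H O hO)) : moduleWeight v X ≠ 0 := by
  rw [moduleWeight, Ne, ENNReal.ofReal_eq_zero, not_le]
  have : Finite (X.carrier ≃ₗ[heckeRing H O hO] X.carrier) := DFunLike.finite _
  exact mul_pos (cardPow_pos hmax v X) (by exact_mod_cast Nat.card_pos)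

variable {E : Type*} [Group E] [Fintype E] {H' : Subgroup E} {O' : ZSub S (MonoidAlgebra ℚ E)}
  {hO : IsOrder S 1 O} {hO' : IsOrder S 1 O'} {π : E →* G} {hπ : Function.Surjective π}

/-- `θ` matches the elements `ε e₁'` with their counterparts, so `f` maps each component onto the
corresponding one. -/
theorem cardPow_eq_of_semilinear (ha : inflation π hπ (avg H) = avg H')
    (θ : heckeRing H O hO ≃+* heckeRing H' O' hO')
    (hθ : ∀ a, heckeVal (θ a) = inflation π hπ (heckeVal a))
    (β : Comp (augIdem H) ≃ Comp (augIdem H')) (hβ : ∀ ε, (β ε).1 = inflation π hπ ε.1)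
    {v : Comp (augIdem H) → ℂ} {v' : Comp (augIdem H') → ℂ} (hv : ∀ ε, v' (β ε) = v ε)
    {X : FinMod (heckeRing H O hO)} {Y : FinMod (heckeRing H' O' hO')}
    (f : X.carrier ≃+ Y.carrier) (hf : ∀ a x, f (a • x) = θ a • f x) :
    cardPow v' Y = cardPow v X := by
  have hpart : ∀ ε, compPart (β ε) Y = f '' compPart ε X := by
    intro ε
    have hval : ∀ a : heckeRing H O hO, heckeVal (θ a) = (β ε).1 * avg H' ↔
        heckeVal a = ε.1 * avg H := fun a => by
      rw [hθ, hβ, ← ha, ← map_mul, (inflation_injective π hπ).eq_iff]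
    ext y
    constructor
    · rintro ⟨b, hb, z, rfl⟩
      refine ⟨θ.symm b • f.symm z, ⟨θ.symm b, (hval _).mp ?_, _, rfl⟩, ?_⟩
      · rw [θ.apply_symm_apply, hb]
      · rw [hf, θ.apply_symm_apply, f.apply_symm_apply]
    · rintro ⟨_, ⟨a, ha', x, rfl⟩, rfl⟩
      exact ⟨θ a, (hval a).mpr ha', f x, hf a x⟩
  unfold cardPow
  rw [← finprod_comp_equiv β]
  refine finprod_congr fun ε => ?_
  rw [hpart, hv, Set.ncard_image_of_injective _ f.injective]

theorem isRandomModuleLaw_apply_eq (hmax : IsMaximalOrder S 1 O)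
    (ha : inflation π hπ (avg H) = avg H')
    (θ : heckeRing H O hO ≃+* heckeRing H' O' hO')
    (hθ : ∀ a, heckeVal (θ a) = inflation π hπ (heckeVal a))
    (β : Comp (augIdem H) ≃ Comp (augIdem H')) (hβ : ∀ ε, (β ε).1 = inflation π hπ ε.1)
    {v : Comp (augIdem H) → ℂ} {v' : Comp (augIdem H') → ℂ} (hv : ∀ ε, v' (β ε) = v ε)
    {P : PMF (FinModClass (heckeRing H O hO))} {Q : PMF (FinModClass (heckeRing H' O' hO'))}
    (hP : IsRandomModuleLaw v P) (hQ : IsRandomModuleLaw v' Q)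
    {X : FinMod (heckeRing H O hO)} {Y : FinMod (heckeRing H' O' hO')}
    (f : X.carrier ≃+ Y.carrier) (hf : ∀ a x, f (a • x) = θ a • f x) : P ⟦X⟧ = Q ⟦Y⟧ := by
  have hw : ∀ (X : FinMod (heckeRing H O hO)) (Y : FinMod (heckeRing H' O' hO'))
      (f : X.carrier ≃+ Y.carrier), (∀ a x, f (a • x) = θ a • f x) →
      moduleWeight v' Y = moduleWeight v X := fun X Y f hf => by
    rw [moduleWeight, moduleWeight, cardPow_eq_of_semilinear ha θ hθ β hβ hv f hf,
      card_aut_eq f hf]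
  have hT : FinModClass.transport θ ⟦X⟧ = ⟦Y⟧ :=
    Quotient.sound ((FinMod.transport_equiv_iff θ X Y).mpr ⟨f, hf⟩)
  rw [← hT]
  -- Weights live on modules, so they are read off on classes through chosen representatives; the
  -- representatives of corresponding classes are related by some semilinear isomorphism, which
  -- suffices.
  refine PMF.eq_of_mul_weight_eq (FinModClass.transport θ) P Q
    (w := fun c => moduleWeight v c.out) (w' := fun c => moduleWeight v' c.out) (fun c => ?_)
    (fun c => moduleWeight_ne_zero hmax v _) (fun c => ENNReal.ofReal_ne_top) (fun c d => ?_)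
    (fun c d => ?_) _
  · have h1 : FinModClass.transport θ ⟦c.out⟧ = ⟦(FinModClass.transport θ c).out⟧ := by
      rw [Quotient.out_eq, Quotient.out_eq]
    obtain ⟨g, hg⟩ := (FinMod.transport_equiv_iff θ _ _).mp (Quotient.exact h1)
    exact hw _ _ g hg
  · have := hP c.out d.out
    rwa [Quotient.out_eq, Quotient.out_eq] at this
  · have := hQ c.out d.out
    rwa [Quotient.out_eq, Quotient.out_eq] at this

end Laws

end CohenMartinet

end

/-! ### The main theorem -/

theorem mainTheorem10
    {K₀ K L M : Type*} [Field K₀] [NumberField K₀] [Field K] [Field L] [Field M]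
    [Algebra K₀ K] [Algebra K₀ L] [Algebra K₀ M] [Algebra K L] [Algebra K M] [Algebra L M]
    [IsScalarTower K₀ K L] [IsScalarTower K₀ K M] [IsScalarTower K₀ L M] [IsScalarTower K L M]
    [FiniteDimensional K₀ K] [FiniteDimensional K₀ L] [FiniteDimensional K₀ M]
    [IsGalois K₀ L] [IsGalois K₀ M] [IsNormalClosure K₀ K L]
    {Γ Ξ : Type*} [Group Γ] [Fintype Γ] [Group Ξ] [Fintype Ξ]
    (τL : Gal(L/K₀) ≃* Γ) (τM : Gal(M/K₀) ≃* Ξ)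
    (Γ' : Subgroup Γ) (hΓ' : Γ' = galImage K₀ L K τL)
    (Ξ' : Subgroup Ξ) (hΞ' : Ξ' = galImage K₀ M K τM)
    (S : Set Nat.Primes)
    (hS : ∀ p ∈ S, IsGoodPrime p (augIdem Γ') ∧ IsGoodPrime p (augIdem Ξ'))
    (φ : Comp (augIdem Γ') → Γ → ℂ) (hφ : ∀ ε, IsAbsIrrCharIn ε.1 (φ ε))
    (ψ : Comp (augIdem Ξ') → Ξ → ℂ) (hψ : ∀ ε, IsAbsIrrCharIn ε.1 (ψ ε)) :
    -- the ranks agree, under the correspondence of irreducible central idempotents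
    (∃ β : Comp (augIdem Γ') ≃ Comp (augIdem Ξ'),
      (∀ ε, (β ε).1 = inflation (restrictHom τL τM) (restrictHom_surjective τL τM) ε.1) ∧
      ∀ ε, fixedRank K₀ M τM Ξ' ψ (β ε) = fixedRank K₀ L τL Γ' φ ε) ∧
    ∀ (O : ZSub S (MonoidAlgebra ℚ Γ)) (O' : ZSub S (MonoidAlgebra ℚ Ξ))
      (hO : IsMaximalOrder S 1 O) (hO' : IsMaximalOrder S 1 O'),
      (∀ x ∈ O, cosetSum (restrictHom τL τM) x ∈ O') →
      -- the modules of invariants are isomorphic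
      (∃ ι : leftInv Γ' (lmul (augIdem Γ') O) ≃+ leftInv Ξ' (lmul (augIdem Ξ') O'),
        ∀ x, (ι x : MonoidAlgebra ℚ Ξ) =
          inflation (restrictHom τL τM) (restrictHom_surjective τL τM) x) ∧
      ∃ θ : heckeRing Γ' O hO.1 ≃+* heckeRing Ξ' O' hO'.1,
        (∀ a, heckeVal (θ a) =
          inflation (restrictHom τL τM) (restrictHom_surjective τL τM) (heckeVal a)) ∧
        -- the predicted distributions agree, under the identification of modules through `θ`
        (∀ (X : FinMod (heckeRing Γ' O hO.1)) (Y : FinMod (heckeRing Ξ' O' hO'.1))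
          (f : X.carrier ≃+ Y.carrier), (∀ a x, f (a • x) = θ a • f x) →
          cardPow (fixedRank K₀ M τM Ξ' ψ) Y = cardPow (fixedRank K₀ L τL Γ' φ) X) ∧
        ∀ (P : PMF (FinModClass (heckeRing Γ' O hO.1)))
          (Q : PMF (FinModClass (heckeRing Ξ' O' hO'.1))),
          IsRandomModuleLaw (fixedRank K₀ L τL Γ' φ) P →
          IsRandomModuleLaw (fixedRank K₀ M τM Ξ' ψ) Q →
          ∀ (X : FinMod (heckeRing Γ' O hO.1)) (Y : FinMod (heckeRing Ξ' O' hO'.1))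
            (f : X.carrier ≃+ Y.carrier), (∀ a x, f (a • x) = θ a • f x) →
            P ⟦X⟧ = Q ⟦Y⟧ := by
  subst hΓ'
  have hπ := restrictHom_surjective τL τM
  have hΞ : Ξ' = (galImage K₀ L K τL).comap (restrictHom τL τM) :=
    hΞ'.trans (galImage_comap_restrictHom τL τM).symm
  have he : inflation (restrictHom τL τM) hπ (augIdem (galImage K₀ L K τL)) = augIdem Ξ' := by
    rw [inflation_augIdem, hΞ]
  have ha : inflation (restrictHom τL τM) hπ (avg (galImage K₀ L K τL)) = avg Ξ' := by
    rw [inflation_avg, hΞ]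
  have hrank := fixedRank_compEquiv τL τM _ Ξ' hΞ he φ hφ ψ hψ
  refine ⟨⟨compEquiv hπ he, fun ε => rfl, hrank⟩, fun O O' hO hO' hc => ?_⟩
  -- Goodness for `e_{Σ/Σ'}` enters through its integrality at each prime of `S`.
  have h1 : IsInflated hπ (lmul (augIdem (galImage K₀ L K τL)) O) (lmul (augIdem Ξ') O') :=
    he ▸ isInflated_lmul hπ hO hO'.1 hc (augIdem_spec _).1.1.1 fun p hp => he ▸ (hS p hp).2.1
  have h2 := h1.leftInv (galImage K₀ L K τL)
  have h3 := (h1.rmul (avg (galImage K₀ L K τL))).leftInv (galImage K₀ L K τL)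
  rw [← hΞ] at h2 h3
  rw [ha] at h3
  exact ⟨⟨h2.equiv, fun x => rfl⟩, heckeEquiv hO.1 hO'.1 he ha h3, fun a => rfl,
    fun X Y f hf => cardPow_eq_of_semilinear ha _ (fun a => rfl) (compEquiv hπ he)
      (fun ε => rfl) hrank f hf,
    fun P Q hP hQ X Y f hf => isRandomModuleLaw_apply_eq hO ha _ (fun a => rfl) (compEquiv hπ he)
      (fun ε => rfl) hrank hP hQ f hf⟩
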